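/- **Setting.** Let $d\ge 1$, $B>0$, and let $(x_1,y_1),(x_2,y_2),\dots$ be i.i.d. with the law of a pair $(x,y)$ taking values in $[0,1]^d\times[-B,B]$. For measurable $g:[0,1]^d\to\mathbf R$ let $R(g)=\mathbb E[(g(x)-y)^2]$. *Mondrian process.* Nodes are the finite words on $\{0,1\}$; the root is the empty word, and the children of $v$ are $v0$ and $v1$. The law $\mathrm{MP}$ of the infinite Mondrian partition $\Pi$ of $[0,1]^d$ is defined recursively: the root has cell $[0,1]^d$ and birth time $\tau=0$. A node $v$ with birth time $\tau_v$, whose cell $C_v$ is a box with side lengths $|C_v^1|,\dots,|C_v^d|$ and $|C_v|=\sum_j|C_v^j|$, waits a time $E_v\sim\mathrm{Exp}(|C_v|)$, and is then split along a coordinate $j_v$ (equal to $j$ with probability $|C_v^j|/|C_v|$), independent of $E_v$, at a threshold $s_v$ uniform on the $j_v$-th side given $j_v$; then $C_{v0}=\{u\in C_v:u_{j_v}\le s_v\}$, $C_{v1}=C_v\setminus C_{v0}$, $\tau_{v0}=\tau_{v1}=\tau_v+E_v$, and both children are split further in the same way with independent randomness. For $\lambda>0$, $\Pi_\lambda\sim\mathrm{MP}(\lambda)$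 is obtained from $\Pi\sim\mathrm{MP}$ by removing all nodes $v$ with $\tau_v>\lambda$; its cells are the $C_v$ for the leaves $v$ of the remaining tree. *AMF.* Let $\Pi\sim\mathrm{MP}$ be independent of the data. For a node $v$ and $t\ge1$ let $\widehat y_{v,t}$ be the mean of the $y_s$ with $1\le s\le t-1$, $x_s\in C_v$ ($0$ if there are none). For a finite subtree $T$ of the infinite binary tree (containing the root, every node having $0$ or $2$ children in $T$), let $|T|$ be its number of nodes, let $\widehat y_{T,t}(u)=\widehat y_{v,t}$ where $v$ is the leaf of $T$ with $u\in C_v$, and let $L_t(T)=\sum_{s=1}^t(\widehat y_{T,s}(x_s)-y_s)^2$. With $\eta=1/(8B^2)$, the AMF prediction function is $$\widehat f_t(u)=\frac{\sum_T 2^{-|T|}e^{-\eta L_{t-1}(T)}\,\widehat y_{T,t}(u)}{\sum_T 2^{-|T|}e^{-\eta L_{t-1}(T)}}.$$ Its online-to-batch conversion is $\widetilde f_n=\widehat f_{I_n}$, with $I_n$ uniform on $\{1,\dots,n\}$ and independent of $\Pi$ and the data. **Theorem.** Let $n\ge2$ and $\lambda>0$, let $\Pi'_\lambda\sim\mathrm{MP}(\lambda)$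 be the time pruning of an infinite Mondrian partition $\Pi'\sim\mathrm{MP}$ (for instance, but not necessarily, $\Pi'=\Pi$), and let $g_\lambda:[0,1]^d\to\mathbf R$ be a (measurable) random function that is almost surely constant on the cells of $\Pi'_\lambda$. Then $\mathbb E[R(\widetilde f_n)]<\infty$ and $$\mathbb E[R(\widetilde f_n)]-\mathbb E[R(g_\lambda)]\le 8B^2(1+\lambda)^d\,\frac{\log n}{n},$$ where the expectations are over all the randomness and $\mathbb E[R(g_\lambda)]\in[0,\infty]$. -/

import Mathlib

open MeasureTheory ProbabilityTheory
open scoped ENNReal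

/-- The cube `[0,1]^d`. -/
abbrev Cube (d : ℕ) : Type := Fin d → unitInterval

/-- A node of the complete binary tree, that is, a finite word on `{0, 1}`, with `0 = false` (left)
and `1 = true` (right). A word is stored with its LAST letter first: the root is `[]`, and the left
and right children of `v` are `false :: v` and `true :: v`. -/
abbrev Node : Type := List Bool

/-- An infinite tree partition with split times: to each node `v` are attached the waiting time
`E_v` before `v` is split, the split coordinate `j_v` and the split threshold `s_v`. -/
abbrev TreePartition (d : ℕ) : Type := Node → ℝ × Fin d × ℝ

namespace TreePartition

variable {d : ℕ}

/-- The waiting time `E_v`. -/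
def wait (p : TreePartition d) (v : Node) : ℝ := (p v).1

/-- The split coordinate `j_v`. -/
def coord (p : TreePartition d) (v : Node) : Fin d := (p v).2.1

/-- The split threshold `s_v`. -/
def thr (p : TreePartition d) (v : Node) : ℝ := (p v).2.2

/-- The cell `C_v ⊆ [0,1]^d` of a node. -/
def cell (p : TreePartition d) : Node → Set (Cube d)
  | [] => Set.univ
  | false :: v => {x ∈ cell p v | (x (p.coord v) : ℝ) ≤ p.thr v}
  | true :: v => cell p v \ {x ∈ cell p v | (x (p.coord v) : ℝ) ≤ p.thr v}

/-- The birth (creation) time `τ_v` of a node: `0` for the root, `τ_v + E_v` for the children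
of `v`. -/
def birth (p : TreePartition d) : Node → ℝ
  | [] => 0
  | _ :: v => birth p v + p.wait v

/-- `v` is a leaf of the time pruning at time `l`, which keeps the nodes created at time `≤ l`:
`v` is kept and its two children, which are created at time `τ_v + E_v`, are not. -/
def IsLeafAt (p : TreePartition d) (l : ℝ) (v : Node) : Prop :=
  p.birth v ≤ l ∧ l < p.birth v + p.wait v

/-- `g` is constant on the cells of the time pruning of `p` at time `l`. -/
def ConstOnCells (p : TreePartition d) (l : ℝ) (g : Cube d → ℝ) : Prop :=
  ∀ v : Node, p.IsLeafAt l v → ∀ x ∈ p.cell v, ∀ x' ∈ p.cell v, g x = g x'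

end TreePartition

/-! ### The Mondrian process -/

section Mondrian

variable {d : ℕ}

/-- A box with lower endpoints `b.1` and upper endpoints `b.2`. -/
abbrev Box (d : ℕ) : Type := (Fin d → ℝ) × (Fin d → ℝ)

/-- The length `|C^j|` of the `j`-th side. -/
def Box.side (b : Box d) (j : Fin d) : ℝ := b.2 j - b.1 j

/-- The linear dimension `|C|`, the sum of the side lengths. -/
def Box.dim (b : Box d) : ℝ := ∑ j, b.side j

/-- The left (`false`) or right (`true`) part of a box split at coordinate `j` and threshold `s`. -/
def Box.child (b : Box d) (j : Fin d) (s : ℝ) : Bool → Box d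
  | false => (b.1, Function.update b.2 j s)
  | true => (Function.update b.1 j s, b.2)

/-- The law of the randomness used at one node: an `Exp(1)` variable and two uniform variables
on `[0,1]`, all independent. -/
noncomputable def nodeSeed : Measure (ℝ × ℝ × ℝ) :=
  (expMeasure 1).prod
    ((volume.restrict (Set.Icc (0 : ℝ) 1)).prod (volume.restrict (Set.Icc (0 : ℝ) 1)))

/-- The split coordinate selected by `u`: the first `j` with `u |C| ≤ |C^1| + ⋯ + |C^j|`. For `u`
uniform on `[0,1]` it is equal to `j` with probability `|C^j| / |C|`. -/
noncomputable def Box.pick [NeZero d] (b : Box d) (u : ℝ) : Fin d :=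
  sInf {j | u * b.dim ≤ ∑ i ∈ Finset.Iic j, b.side i}

/-- Sampling of the waiting time, split coordinate and split threshold of a cell from a seed
`(e, u, w)`: the waiting time `e / |C|` is `Exp(|C|)`-distributed, the coordinate is `j` with
probability `|C^j| / |C|`, and the threshold is uniform on the `j`-th side given `j`. -/
noncomputable def sampleSplit [NeZero d] (b : Box d) (r : ℝ × ℝ × ℝ) : ℝ × Fin d × ℝ :=
  (r.1 / b.dim, b.pick r.2.1, b.1 (b.pick r.2.1) + r.2.2 * b.side (b.pick r.2.1))

/-- The box of a node when the recursive sampling is run on the family of seeds `r`. -/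
noncomputable def sampleBox [NeZero d] (r : Node → ℝ × ℝ × ℝ) : Node → Box d
  | [] => (fun _ => 0, fun _ => 1)
  | a :: v =>
    (sampleBox r v).child (sampleSplit (sampleBox r v) (r v)).2.1
      (sampleSplit (sampleBox r v) (r v)).2.2 a

/-- The infinite tree partition produced by the recursive sampling from the seeds `r`. -/
noncomputable def sampleMondrian [NeZero d] (r : Node → ℝ × ℝ × ℝ) : TreePartition d :=
  fun v => sampleSplit (sampleBox r v) (r v)

/-- The law `MP` of the infinite Mondrian process on `[0,1]^d`: every cell is split recursively
with independent randomness. -/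
noncomputable def mondrianMeasure (d : ℕ) [NeZero d] : Measure (TreePartition d) :=
  (Measure.infinitePi fun _ : Node => nodeSeed).map sampleMondrian

end Mondrian

/-! The Mondrian law is a probability measure. -/

theorem measurable_child {d : ℕ} (a : Bool) :
    Measurable fun q : Box d × Fin d × ℝ => q.1.child q.2.1 q.2.2 a := by
  have key : ∀ f : Box d × Fin d × ℝ → Fin d → ℝ, Measurable f →
      Measurable fun q => Function.update (f q) q.2.1 q.2.2 := by
    intro f hf
    refine measurable_pi_iff.2 fun i => ?_
    have : (fun q : Box d × Fin d × ℝ => Function.update (f q) q.2.1 q.2.2 i) =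
        fun q => if q.2.1 = i then q.2.2 else f q i := by
      ext q
      by_cases h : q.2.1 = i
      · subst h; simp
      · simp [h, Function.update_of_ne (Ne.symm h)]
    rw [this]
    refine Measurable.ite ?_ (by fun_prop) (by fun_prop)
    exact (by fun_prop : Measurable fun q : Box d × Fin d × ℝ => q.2.1) (measurableSet_singleton i)
  cases a
  · exact (by fun_prop : Measurable fun q : Box d × Fin d × ℝ => q.1.1).prodMk
      (key _ (by fun_prop))
  · exact (key _ (by fun_prop)).prodMk (by fun_prop)

theorem measurable_dim {d : ℕ} : Measurable fun b : Box d => b.dim := by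
  unfold Box.dim Box.side; fun_prop

theorem measurable_eval_fin {d : ℕ} : Measurable fun r : (Fin d → ℝ) × Fin d => r.1 r.2 := by
  have : (fun r : (Fin d → ℝ) × Fin d => r.1 r.2) =
      fun r => ∑ j, if r.2 = j then r.1 j else 0 := by ext r; simp
  rw [this]
  refine Finset.measurable_fun_sum _ fun j _ => Measurable.ite ?_ (by fun_prop) (by fun_prop)
  exact measurable_snd (measurableSet_singleton j)

section MondrianFacts

variable {d : ℕ} [NeZero d]

instance : IsProbabilityMeasure nodeSeed := by
  have := isProbabilityMeasure_expMeasure (r := 1) one_pos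
  have : IsProbabilityMeasure (volume.restrict (Set.Icc (0 : ℝ) 1)) := ⟨by simp⟩
  unfold nodeSeed
  infer_instance

theorem measurable_pick :
    Measurable fun q : Box d × ℝ => q.1.pick q.2 := by
  have hd : Measurable fun q : Box d × ℝ => q.2 * q.1.dim := by
    unfold Box.dim Box.side; fun_prop
  have hs : ∀ j, Measurable fun q : Box d × ℝ => ∑ i ∈ Finset.Iic j, q.1.side i := by
    unfold Box.side; fun_prop
  have h1 : Measurable fun q : Box d × ℝ =>
      {j : Fin d | q.2 * q.1.dim ≤ ∑ i ∈ Finset.Iic j, q.1.side i} :=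
    measurable_set_iff.2 fun j => measurableSet_setOfPred.1 (measurableSet_le hd (hs j))
  have h2 : Measurable fun s : Set (Fin d) => sInf s := by
    have : Measurable fun s : Set (Fin d) => fun j => (j ∈ s) :=
      measurable_pi_iff.2 fun j => measurable_set_mem j
    exact (measurable_of_finite (fun f : Fin d → Prop => sInf {j | f j})).comp this
  exact h2.comp h1

theorem measurable_sampleSplit :
    Measurable fun q : Box d × (ℝ × ℝ × ℝ) => sampleSplit q.1 q.2 := by
  have m1 : Measurable fun q : Box d × (ℝ × ℝ × ℝ) => q.1 := measurable_fst
  have m2 : Measurable fun q : Box d × (ℝ × ℝ × ℝ) => q.2 := measurable_snd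
  have hp := (measurable_pick (d := d)).comp (m1.prodMk m2.snd.fst)
  have h1 := measurable_eval_fin.comp (m1.fst.prodMk hp)
  have h2 := measurable_eval_fin.comp (m1.snd.prodMk hp)
  have h3 := (measurable_dim (d := d)).comp m1
  exact (m2.fst.div h3).prodMk
    (hp.prodMk (h1.add (m2.snd.snd.mul (h2.sub h1))))

theorem measurable_sampleBox (v : Node) :
    Measurable fun r : Node → ℝ × ℝ × ℝ => (sampleBox r v : Box d) := by
  induction v with
  | nil => exact measurable_const
  | cons a v ih =>
    have h1 : Measurable fun r : Node → ℝ × ℝ × ℝ => sampleSplit (sampleBox r v : Box d) (r v) :=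
      measurable_sampleSplit.comp (ih.prodMk (by fun_prop))
    exact (measurable_child a).comp (ih.prodMk h1.snd)

theorem measurable_sampleMondrian :
    Measurable (sampleMondrian : (Node → ℝ × ℝ × ℝ) → TreePartition d) :=
  measurable_pi_iff.2 fun v =>
    measurable_sampleSplit.comp ((measurable_sampleBox v).prodMk (by fun_prop))

instance : IsProbabilityMeasure (mondrianMeasure d) :=
  Measure.isProbabilityMeasure_map measurable_sampleMondrian.aemeasurable

end MondrianFacts

/-! ### Aggregation -/

/-- Finite ordered binary trees in which every node has no child or two children: the finite
subtrees (containing the root) of the infinite binary tree. -/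
inductive BinTree : Type
  | leaf : BinTree
  | split (left right : BinTree) : BinTree

/-- The number `|T|` of nodes, leaves included. -/
def BinTree.size : BinTree → ℕ
  | .leaf => 1
  | .split l r => 1 + l.size + r.size

section AMF

variable {d : ℕ}

open Classical in
/-- The prediction of the node `v` from the first `t` samples: the mean of the `y_s` such that
`x_s` is in the cell of `v`, and `0` if there is no such sample (`0 / 0 = 0`). Samples are indexed
from `0`, so this is the prediction between the `t`-th and the `(t+1)`-th sample. -/
noncomputable def nodePred (p : TreePartition d) (z : ℕ → Cube d × ℝ) (v : Node) (t : ℕ) : ℝ :=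
  (∑ s ∈ Finset.range t with (z s).1 ∈ p.cell v, (z s).2) /
    (((Finset.range t).filter fun s => (z s).1 ∈ p.cell v).card : ℝ)

open Classical in
/-- The node at which `x` ends when it is sent from the node `v` down the tree `T` rooted at `v`. -/
noncomputable def BinTree.leafFrom (p : TreePartition d) (x : Cube d) : BinTree → Node → Node
  | .leaf, v => v
  | .split l r, v =>
    if (x (p.coord v) : ℝ) ≤ p.thr v then l.leafFrom p x (false :: v)
    else r.leafFrom p x (true :: v)

/-- The prediction at `x` of the subtree `T` from the first `t` samples: the prediction of the leaf
of `T` whose cell contains `x`. -/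
noncomputable def treePred (p : TreePartition d) (z : ℕ → Cube d × ℝ) (T : BinTree) (t : ℕ)
    (x : Cube d) : ℝ :=
  nodePred p z (T.leafFrom p x []) t

/-- The cumulative quadratic loss of the subtree `T` on the first `t` samples. -/
noncomputable def treeLoss (p : TreePartition d) (z : ℕ → Cube d × ℝ) (T : BinTree) (t : ℕ) : ℝ :=
  ∑ s ∈ Finset.range t, (treePred p z T s (z s).1 - (z s).2) ^ 2

/-- The unnormalized weight `π(T) exp(-η L(T))` of a subtree after `t` samples, with the prior
`π(T) = 2^{-|T|}`. -/
noncomputable def treeWeight (η : ℝ) (p : TreePartition d) (z : ℕ → Cube d × ℝ) (t : ℕ)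
    (T : BinTree) : ℝ :=
  (1 / 2 : ℝ) ^ T.size * Real.exp (-η * treeLoss p z T t)

/-- The prediction function of AMF with learning rate `η`, built on the infinite tree partition `p`
and on the first `t` samples: the exponentially weighted average of all finite subtrees. -/
noncomputable def amf (η : ℝ) (p : TreePartition d) (z : ℕ → Cube d × ℝ) (t : ℕ) (x : Cube d) : ℝ :=
  (∑' T : BinTree, treeWeight η p z t T * treePred p z T t x) / ∑' T : BinTree, treeWeight η p z t T

/-- The quadratic risk `R(g) = 𝔼[(g(x) - y)^2]`, with `(x, y)` of law `P`, as an element of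
`[0, ∞]`. -/
noncomputable def risk (P : Measure (Cube d × ℝ)) (g : Cube d → ℝ) : ℝ≥0∞ :=
  ∫⁻ z, ENNReal.ofReal ((g z.1 - z.2) ^ 2) ∂P

end AMF

/-! ### The prior on finite binary trees -/

namespace BinTree

/-! Condition on the comparison partition and suppose that its time pruning at `lam` is a finite
tree `T` with `N` leaves. AMF is then compared with `T`, whose leaves predict running means, and `T`
with the best constants on its leaves.

Aggregation: on `[-B, B]` the quadratic loss is exp-concave with rate `1 / (8 * B ^ 2)`, so the
total exponential weight decays at least as fast as the exponential of minus the rate times AMF's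
cumulative loss. Keeping only the weight of `T` bounds the regret by `8 * B ^ 2 * |T| * log 2`,
where `|T| = 2 * N - 1` (`sum_amf_loss_le`, `BinTree.size_add_one_eq`).

Estimation: on one cell, a running mean based on `k ≥ 1` visits has an excess loss of the
conditional variance divided by `k`. Summing over visits gives an expected regret of at most `B ^ 2
* harmonic (n - 1)` per leaf against any constant (`sum_integral_runningMean_loss_le`).

Each predictor uses past samples only, so its expected loss on the next sample is its expected risk,
and averaging over the random step turns regret into risk (`lintegral_risk_amf_eq`,
`lintegral_risk_online_to_batch`). The two costs fit in `8 * B ^ 2 * N * log n`, except in some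
cases with `n ≤ 5`, where the trivial bound on the risk suffices (`regret_budget`).

It remains to average over the Mondrian law. The function `∏ j, (1 + s * |C^j|)` solves the
branching recursion of the expected leaf count, whence `E N ≤ (1 + lam) ^ d`
(`lintegral_leaf_count_le`). A bound on the leaf count does not exclude infinite branches;
finiteness of the pruning comes separately from a Laplace transform and Borel–Cantelli
(`ae_finite_pruning`). Only the law of the partition matters, so AMF's partition and the comparison
partition need not be coupled. -/

noncomputable instance : DecidableEq BinTree := Classical.decEq _

/-- The binary trees of height less than `k`. -/
noncomputable def heightLT : ℕ → Finset BinTree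
  | 0 => ∅
  | k + 1 => insert leaf ((heightLT k ×ˢ heightLT k).image fun q => split q.1 q.2)

theorem heightLT_subset_succ (k : ℕ) : heightLT k ⊆ heightLT (k + 1) := by
  induction k with
  | zero => simp [heightLT]
  | succ k ih =>
    rw [heightLT]
    exact Finset.insert_subset_insert _ (Finset.image_subset_image (Finset.product_subset_product ih ih))

theorem heightLT_mono : Monotone heightLT := monotone_nat_of_le_succ heightLT_subset_succ

theorem mem_heightLT_size (T : BinTree) : T ∈ heightLT T.size := by
  induction T with
  | leaf => simp [heightLT, size]
  | split l r hl hr =>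
    have h1 : (split l r).size = (l.size + r.size) + 1 := by simp [size]; omega
    rw [h1, heightLT]
    refine Finset.mem_insert_of_mem (Finset.mem_image.2 ⟨(l, r), ?_, rfl⟩)
    exact Finset.mem_product.2 ⟨heightLT_mono (by omega) hl, heightLT_mono (by omega) hr⟩

theorem tendsto_heightLT : Filter.Tendsto heightLT Filter.atTop Filter.atTop :=
  Filter.tendsto_atTop_finset_of_monotone heightLT_mono fun T => ⟨_, mem_heightLT_size T⟩

instance : Countable BinTree := by
  have : (Set.univ : Set BinTree) = ⋃ k, (heightLT k : Set BinTree) := by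
    ext T; simpa using ⟨_, mem_heightLT_size T⟩
  rw [← Set.countable_univ_iff, this]
  exact Set.countable_iUnion fun k => (heightLT k).countable_toSet

/-- With `S k` the sum over heights less than `k`, splitting at the root gives `S (k + 1) = 1 / 2 +
S k ^ 2 / 2`, which preserves `S k ≤ 1`. This is the probability that a critical binary branching
tree has height less than `k`. -/
theorem sum_heightLT_le_one (k : ℕ) : ∑ T ∈ heightLT k, (1 / 2 : ℝ) ^ T.size ≤ 1 := by
  classical
  induction k with
  | zero => simp [heightLT]
  | succ k ih =>
    rw [heightLT, Finset.sum_insert (by simp), Finset.sum_image (by rintro ⟨a, b⟩ _ ⟨c, e⟩ _; simp),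
      Finset.sum_product]
    have h0 : 0 ≤ ∑ T ∈ heightLT k, (1 / 2 : ℝ) ^ T.size := Finset.sum_nonneg fun _ _ => by positivity
    have : ∑ x ∈ heightLT k, ∑ y ∈ heightLT k, (1 / 2 : ℝ) ^ (split x y).size =
        1 / 2 * ((∑ T ∈ heightLT k, (1 / 2 : ℝ) ^ T.size) * ∑ T ∈ heightLT k, (1 / 2 : ℝ) ^ T.size) := by
      rw [Finset.sum_mul_sum, Finset.mul_sum]
      refine Finset.sum_congr rfl fun x _ => ?_
      rw [Finset.mul_sum]
      refine Finset.sum_congr rfl fun y _ => ?_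
      simp only [size, pow_add, pow_one]; ring
    rw [this]
    simp only [size, pow_one]
    nlinarith

theorem sum_prior_le_one (s : Finset BinTree) : ∑ T ∈ s, (1 / 2 : ℝ) ^ T.size ≤ 1 := by
  obtain ⟨k, hk⟩ := (tendsto_heightLT.eventually_ge_atTop s).exists
  exact (Finset.sum_le_sum_of_subset_of_nonneg hk fun _ _ _ => by positivity).trans
    (sum_heightLT_le_one k)

theorem summable_prior : Summable fun T : BinTree => (1 / 2 : ℝ) ^ T.size :=
  summable_of_sum_le (fun _ => by positivity) sum_prior_le_one

theorem tsum_prior_le_one : ∑' T : BinTree, (1 / 2 : ℝ) ^ T.size ≤ 1 :=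
  Real.tsum_le_of_sum_le (fun _ => by positivity) sum_prior_le_one

end BinTree

/-! ### Exponentially weighted aggregation -/

/-- The tangent inequality of the concave function `b ↦ exp (-b ^ 2 / 2)` on `[-1, 1]`. -/
theorem exp_half_sq_sub_le {a b : ℝ} (ha : |a| ≤ 1) (hb : |b| ≤ 1) :
    Real.exp ((a ^ 2 - b ^ 2) / 2) ≤ 1 + a * (a - b) := by
  obtain ⟨ha1, ha2⟩ := abs_le.1 ha
  obtain ⟨hb1, hb2⟩ := abs_le.1 hb
  rcases le_or_gt 0 (a * (a - b)) with hx | hx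
  · rw [← Real.le_log_iff_exp_le (by linarith)]
    -- With `x = a * (a - b)`, the left side is `x - (a - b) ^ 2 / 2 ≤ x - x ^ 2 / 2`, because `a ^
    -- 2 ≤ 1`, and this is at most `2 * x / (x + 2) ≤ log (1 + x)`.
    refine le_trans ?_ (Real.le_log_one_add_of_nonneg hx)
    have h1 : (a * (a - b)) ^ 2 ≤ (a - b) ^ 2 := by
      rw [mul_pow]
      exact mul_le_of_le_one_left (sq_nonneg _) (by nlinarith)
    rw [le_div_iff₀ (by linarith)]
    have h2 : (a ^ 2 - b ^ 2) / 2 = a * (a - b) - (a - b) ^ 2 / 2 := by ring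
    rw [h2]
    generalize a * (a - b) = x at *
    nlinarith [mul_nonneg hx (sq_nonneg x)]
  · wlog ha0 : 0 < a generalizing a b
    · have := @this (-a) (-b) (by simpa) (by simpa) (by linarith) (by linarith) (by linarith)
        (by linarith) (by nlinarith) (by
          rcases (not_lt.1 ha0).eq_or_lt with h | h
          · simp [h] at hx
          · linarith)
      convert! this using 2 <;> ring
    have hδ : 0 < b - a := by nlinarith
    obtain ⟨e, he⟩ : ∃ e, e = b - a := ⟨_, rfl⟩
    have hb' : b = a + e := by linarith
    subst hb'
    have he0 : 0 < e := by linarith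
    have hae : a * e ≤ 1 / 4 := by nlinarith [sq_nonneg (a - e)]
    have h1 : (a ^ 2 - (a + e) ^ 2) / 2 = -(a * e + e ^ 2 / 2) := by ring
    rw [h1, Real.exp_neg]
    have h2 := Real.quadratic_le_exp_of_nonneg (by positivity : 0 ≤ a * e + e ^ 2 / 2)
    refine (inv_anti₀ (by positivity) h2).trans ?_
    rw [inv_le_iff_one_le_mul₀ (by positivity)]
    -- Expanding `(1 - a * e) * (1 + u + u ^ 2 / 2)` with `u = a * e + e ^ 2 / 2` leaves, beyond
    -- `1`, exactly `e ^ 2 / 2 * (1 - a ^ 2 * (1 + a * e + e ^ 2)) + e ^ 4 / 8 * (1 - a * e)`; both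
    -- terms are nonnegative since `a + e ≤ 1`.
    have h3 : a ^ 2 * (1 + a * e + e ^ 2) ≤ 1 := by
      have h4 : 1 + a * e + e ^ 2 ≤ 1 + e := by nlinarith
      have h5 : a ^ 2 ≤ (1 - e) ^ 2 := by nlinarith
      have h6 : (1 - e) ^ 2 * (1 + e) ≤ 1 := by nlinarith
      calc _ ≤ (1 - e) ^ 2 * (1 + e) := by gcongr
        _ ≤ 1 := h6
    nlinarith [mul_nonneg (sq_nonneg e) (sub_nonneg.2 h3),
      mul_nonneg (pow_nonneg he0.le 4) (by linarith : 0 ≤ 1 - a * e)]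

/-- Exp-concavity of the quadratic loss on `[-B, B]`, in tangent form. -/
theorem exp_neg_sq_le_tangent {B : ℝ} (hB : 0 < B) {x a y : ℝ} (hx : |x| ≤ B) (ha : |a| ≤ B)
    (hy : |y| ≤ B) :
    Real.exp (-(1 / (8 * B ^ 2)) * (x - y) ^ 2) ≤
      Real.exp (-(1 / (8 * B ^ 2)) * (a - y) ^ 2) * (1 - (a - y) / (4 * B ^ 2) * (x - a)) := by
  -- Residuals lie in `[-2 * B, 2 * B]`. Dividing them by `2 * B` turns the rate `1 / (8 * B ^ 2)`
  -- into the `1 / 2` of the normalized inequality.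
  have h2 : ∀ u : ℝ, |u| ≤ B → |(u - y) / (2 * B)| ≤ 1 := by
    intro u hu
    rw [abs_div, div_le_one (by positivity), abs_of_pos (by positivity : 0 < 2 * B)]
    exact (abs_sub _ _).trans (by linarith)
  have h := exp_half_sq_sub_le (h2 a ha) (h2 x hx)
  have e : -(1 / (8 * B ^ 2)) * (x - y) ^ 2 = -(1 / (8 * B ^ 2)) * (a - y) ^ 2 +
      (((a - y) / (2 * B)) ^ 2 - ((x - y) / (2 * B)) ^ 2) / 2 := by field_simp; ring
  rw [e, Real.exp_add]
  refine mul_le_mul_of_nonneg_left (h.trans (le_of_eq ?_)) (Real.exp_pos _).le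
  field_simp; ring

section Aggregation

variable {d : ℕ} {B : ℝ} {p : TreePartition d} {z : ℕ → Cube d × ℝ}

theorem abs_nodePred_le (hB : 0 ≤ B) {t : ℕ} (hz : ∀ s < t, |(z s).2| ≤ B) (v : Node) :
    |nodePred p z v t| ≤ B := by
  classical
  unfold nodePred
  set F := (Finset.range t).filter fun s => (z s).1 ∈ p.cell v with hF
  have h : |∑ s ∈ F, (z s).2| ≤ F.card * B := by
    refine (Finset.abs_sum_le_sum_abs _ _).trans ?_
    rw [← nsmul_eq_mul]
    refine Finset.sum_le_card_nsmul _ _ _ fun s hs => hz s ?_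
    simpa using (Finset.mem_filter.1 hs).1
  rcases F.card.eq_zero_or_pos with h0 | h0
  · simp [h0, hB]
  · rw [abs_div, Nat.abs_cast, div_le_iff₀ (by positivity)]
    linarith

theorem treeLoss_nonneg (T : BinTree) (t : ℕ) : 0 ≤ treeLoss p z T t :=
  Finset.sum_nonneg fun _ _ => sq_nonneg _

theorem treeWeight_pos (η : ℝ) (t : ℕ) (T : BinTree) : 0 < treeWeight η p z t T := by
  unfold treeWeight; positivity

theorem treeWeight_le {η : ℝ} (hη : 0 ≤ η) (t : ℕ) (T : BinTree) :
    treeWeight η p z t T ≤ (1 / 2 : ℝ) ^ T.size := by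
  unfold treeWeight
  refine mul_le_of_le_one_right (by positivity) (Real.exp_le_one_iff.2 ?_)
  nlinarith [treeLoss_nonneg (p := p) (z := z) T t]

theorem summable_treeWeight {η : ℝ} (hη : 0 ≤ η) (t : ℕ) : Summable (treeWeight η p z t) :=
  BinTree.summable_prior.of_nonneg_of_le (fun T => (treeWeight_pos η t T).le) (treeWeight_le hη t)

theorem tsum_treeWeight_pos {η : ℝ} (hη : 0 ≤ η) (t : ℕ) : 0 < ∑' T, treeWeight η p z t T :=
  (summable_treeWeight hη t).tsum_pos (fun T => (treeWeight_pos η t T).le) .leaf (treeWeight_pos η t _)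

theorem treeWeight_succ (η : ℝ) (t : ℕ) (T : BinTree) :
    treeWeight η p z (t + 1) T = treeWeight η p z t T *
      Real.exp (-η * (treePred p z T t (z t).1 - (z t).2) ^ 2) := by
  unfold treeWeight treeLoss
  rw [Finset.sum_range_succ, mul_add, Real.exp_add]; ring

variable {η : ℝ}

theorem summable_treeWeight_mul_treePred (hη : 0 ≤ η) (hB : 0 ≤ B) {t : ℕ}
    (hz : ∀ s < t, |(z s).2| ≤ B) (x : Cube d) :
    Summable fun T => treeWeight η p z t T * treePred p z T t x := by
  refine Summable.of_norm_bounded ((summable_treeWeight (p := p) (z := z) hη t).mul_right B)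
    fun T => ?_
  rw [norm_mul, Real.norm_of_nonneg (treeWeight_pos η t T).le]
  exact mul_le_mul_of_nonneg_left (abs_nodePred_le hB hz _) (treeWeight_pos η t T).le

theorem abs_amf_le (hη : 0 ≤ η) (hB : 0 ≤ B) {t : ℕ} (hz : ∀ s < t, |(z s).2| ≤ B) (x : Cube d) :
    |amf η p z t x| ≤ B := by
  have hW := tsum_treeWeight_pos (p := p) (z := z) hη t
  unfold amf
  rw [abs_div, abs_of_pos hW, div_le_iff₀ hW, ← tsum_mul_left, ← Real.norm_eq_abs]
  refine tsum_of_norm_bounded ((summable_treeWeight hη t).mul_left B).hasSum fun T => ?_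
  rw [norm_mul, Real.norm_of_nonneg (treeWeight_pos η t T).le, mul_comm]
  exact mul_le_mul_of_nonneg_right (abs_nodePred_le hB hz _) (treeWeight_pos η t T).le

/-- Jensen's inequality for the exp-concave loss: bound each tree's factor by the tangent at the AMF
prediction. That prediction is the weighted mean of the tree predictions, so the linear terms cancel
in the sum. -/
theorem tsum_treeWeight_succ_le (hB : 0 < B) {t : ℕ} (hz : ∀ s < t + 1, |(z s).2| ≤ B) :
    ∑' T, treeWeight (1 / (8 * B ^ 2)) p z (t + 1) T ≤
      (∑' T, treeWeight (1 / (8 * B ^ 2)) p z t T) *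
        Real.exp (-(1 / (8 * B ^ 2)) * (amf (1 / (8 * B ^ 2)) p z t (z t).1 - (z t).2) ^ 2) := by
  set η := 1 / (8 * B ^ 2) with hηd
  have hη : 0 ≤ η := by positivity
  have hz' : ∀ s < t, |(z s).2| ≤ B := fun s hs => hz s (by omega)
  have hy := hz t (by omega)
  have hW := tsum_treeWeight_pos (p := p) (z := z) hη t
  set a := amf η p z t (z t).1 with ha
  set y := (z t).2
  have hs1 := summable_treeWeight (p := p) (z := z) hη t
  have hs2 := summable_treeWeight_mul_treePred (p := p) hη hB.le hz' (z t).1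
  have hsum : ∑' T, treeWeight η p z t T * treePred p z T t (z t).1 =
      a * ∑' T, treeWeight η p z t T := by
    rw [ha, amf, div_mul_cancel₀ _ hW.ne']
  set c := (a - y) / (4 * B ^ 2)
  have hpt : ∀ T, treeWeight η p z (t + 1) T ≤ Real.exp (-η * (a - y) ^ 2) *
      ((1 + c * a) * treeWeight η p z t T - c * (treeWeight η p z t T * treePred p z T t (z t).1)) := by
    intro T
    rw [treeWeight_succ]
    have := exp_neg_sq_le_tangent hB (abs_nodePred_le (p := p) hB.le hz' (T.leafFrom p (z t).1 []))
      (abs_amf_le (p := p) hη hB.le hz' (z t).1) hy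
    refine (mul_le_mul_of_nonneg_left this (treeWeight_pos η t T).le).trans (le_of_eq ?_)
    simp only [treePred]
    ring
  refine (Summable.tsum_le_tsum hpt (summable_treeWeight hη _)
    (((hs1.mul_left _).sub (hs2.mul_left _)).mul_left _)).trans (le_of_eq ?_)
  rw [tsum_mul_left, ((hs1.mul_left _).tsum_sub (hs2.mul_left _)), tsum_mul_left, tsum_mul_left, hsum]
  ring

/-- The regret of AMF against a finite subtree. -/
theorem sum_amf_loss_le (hB : 0 < B) {n : ℕ} (hz : ∀ s < n, |(z s).2| ≤ B) (T : BinTree) :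
    ∑ t ∈ Finset.range n, (amf (1 / (8 * B ^ 2)) p z t (z t).1 - (z t).2) ^ 2 ≤
      treeLoss p z T n + 8 * B ^ 2 * (T.size * Real.log 2) := by
  set η := 1 / (8 * B ^ 2) with hηd
  have hη : 0 < η := by positivity
  -- The total weight is the potential: it starts at most at `1`, and each round multiplies it by at
  -- most the exponential of minus `η` times AMF's loss.
  have key : ∀ m ≤ n, ∑' T, treeWeight η p z m T ≤ Real.exp (-η *
      ∑ t ∈ Finset.range m, (amf η p z t (z t).1 - (z t).2) ^ 2) := by
    intro m
    induction m with
    | zero =>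
      intro _
      simpa [treeWeight, treeLoss] using BinTree.tsum_prior_le_one
    | succ m ih =>
      intro hm
      refine (tsum_treeWeight_succ_le hB fun s hs => hz s (by omega)).trans ?_
      rw [Finset.sum_range_succ, mul_add, Real.exp_add]
      exact mul_le_mul_of_nonneg_right (ih (by omega)) (Real.exp_pos _).le
  have h1 : treeWeight η p z n T ≤ _ :=
    ((summable_treeWeight hη.le n).le_tsum T fun _ _ => (treeWeight_pos η n _).le).trans (key n le_rfl)
  have h2 : treeWeight η p z n T = Real.exp (-(T.size * Real.log 2) - η * treeLoss p z T n) := by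
    unfold treeWeight
    rw [sub_eq_add_neg, Real.exp_add, neg_mul, ← mul_neg (T.size : ℝ), ← Real.log_inv,
      Real.exp_nat_mul, Real.exp_log (by norm_num), one_div]
  rw [h2, Real.exp_le_exp] at h1
  have h3 : 8 * B ^ 2 * η = 1 := by rw [hηd]; field_simp
  have h4 := mul_le_mul_of_nonneg_left h1 (by positivity : 0 ≤ 8 * B ^ 2)
  rw [mul_sub, ← mul_assoc (8 * B ^ 2) η, ← mul_assoc (8 * B ^ 2) (-η), mul_neg _ η, h3] at h4
  linarith

end Aggregation

/-! ### Leaves of a finite subtree -/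

namespace BinTree

/-- The leaves of the tree `T` rooted at `v`. -/
def leavesFrom : BinTree → Node → Finset Node
  | .leaf, v => {v}
  | .split l r, v => l.leavesFrom (false :: v) ∪ r.leavesFrom (true :: v)

theorem suffix_of_mem_leavesFrom {T : BinTree} {v u : Node} (h : u ∈ T.leavesFrom v) : v <:+ u := by
  induction T generalizing v with
  | leaf => simp_all [leavesFrom]
  | split l r hl hr =>
    rcases Finset.mem_union.1 h with h | h
    · exact (List.suffix_cons _ _).trans (hl h)
    · exact (List.suffix_cons _ _).trans (hr h)

theorem disjoint_leavesFrom (l r : BinTree) (v : Node) :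
    Disjoint (l.leavesFrom (false :: v)) (r.leavesFrom (true :: v)) := by
  rw [Finset.disjoint_left]
  intro u h1 h2
  obtain ⟨a, ha⟩ := suffix_of_mem_leavesFrom h1
  obtain ⟨b, hb⟩ := suffix_of_mem_leavesFrom h2
  simpa using (List.append_inj' (ha.trans hb.symm) (by simp)).2

/-- Converts the prior cost, counted in nodes, into a number of leaves, the quantity whose mean
under the Mondrian law is controlled. -/
theorem size_add_one_eq (T : BinTree) (v : Node) : T.size + 1 = 2 * (T.leavesFrom v).card := by
  induction T generalizing v with
  | leaf => simp [size, leavesFrom]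
  | split l r hl hr =>
    rw [leavesFrom, Finset.card_union_of_disjoint (disjoint_leavesFrom l r v), size]
    have := hl (false :: v); have := hr (true :: v); omega

end BinTree

section Cells

variable {d : ℕ} {p : TreePartition d}

theorem cell_cons_subset (a : Bool) (v : Node) : p.cell (a :: v) ⊆ p.cell v := by
  cases a
  · exact Set.sep_subset _ _
  · exact Set.sdiff_subset

theorem cell_subset_of_suffix {u v : Node} (h : v <:+ u) : p.cell u ⊆ p.cell v := by
  obtain ⟨w, rfl⟩ := h
  induction w with
  | nil => rfl
  | cons a w ih => exact (cell_cons_subset a _).trans ih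

theorem mem_cell_true {v : Node} {x : Cube d} :
    x ∈ p.cell (true :: v) ↔ x ∈ p.cell v ∧ ¬ (x (p.coord v) : ℝ) ≤ p.thr v := by
  simp only [TreePartition.cell, Set.mem_sdiff, Set.mem_ofPred_eq]; tauto

theorem mem_cell_false {v : Node} {x : Cube d} :
    x ∈ p.cell (false :: v) ↔ x ∈ p.cell v ∧ (x (p.coord v) : ℝ) ≤ p.thr v := Iff.rfl

theorem leafFrom_mem_leavesFrom (T : BinTree) (x : Cube d) (v : Node) :
    T.leafFrom p x v ∈ T.leavesFrom v := by
  induction T generalizing v with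
  | leaf => simp [BinTree.leafFrom, BinTree.leavesFrom]
  | split l r hl hr =>
    rw [BinTree.leafFrom, BinTree.leavesFrom, Finset.mem_union]
    split_ifs
    · exact .inl (hl _)
    · exact .inr (hr _)

/-- The leaf cells partition the cell of the root of `T`: cells shrink along branches, so a point in
the cell of a leaf below one child must pass the split test of that child. -/
theorem mem_cell_leaf_iff {T : BinTree} {x : Cube d} {u v : Node} (hx : x ∈ p.cell v)
    (hu : u ∈ T.leavesFrom v) : x ∈ p.cell u ↔ T.leafFrom p x v = u := by
  induction T generalizing v with
  | leaf =>
    rw [BinTree.leavesFrom, Finset.mem_singleton] at hu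
    simp [hu, hx, BinTree.leafFrom]
  | split l r hl hr =>
    rw [BinTree.leavesFrom, Finset.mem_union] at hu
    rw [BinTree.leafFrom]
    have hl' : u ∈ l.leavesFrom (false :: v) → u ∉ r.leavesFrom (true :: v) :=
      fun h => Finset.disjoint_left.1 (BinTree.disjoint_leavesFrom l r v) h
    split_ifs with h
    · rcases hu with hu | hu
      · exact hl (mem_cell_false.2 ⟨hx, h⟩) hu
      · refine iff_of_false (fun hxu => ?_) fun e => hl' (e ▸ leafFrom_mem_leavesFrom l x _) hu
        exact (mem_cell_true.1 (cell_subset_of_suffix (BinTree.suffix_of_mem_leavesFrom hu) hxu)).2 h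
    · rcases hu with hu | hu
      · refine iff_of_false (fun hxu => ?_) fun e => hl' hu (e ▸ leafFrom_mem_leavesFrom r x _)
        exact h (mem_cell_false.1 (cell_subset_of_suffix (BinTree.suffix_of_mem_leavesFrom hu) hxu)).2
      · exact hr (mem_cell_true.2 ⟨hx, h⟩) hu

open Classical in
/-- A sum over the leaves of `T` whose cell contains `x` reduces to one term. -/
theorem sum_leaves_ite (T : BinTree) (x : Cube d) {β : Type*} [AddCommMonoid β] (f : Node → β) :
    ∑ u ∈ T.leavesFrom [], (if x ∈ p.cell u then f u else 0) = f (T.leafFrom p x []) := by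
  have : ∀ u ∈ T.leavesFrom [], (if x ∈ p.cell u then f u else 0) =
      if T.leafFrom p x [] = u then f u else 0 := fun u hu => by
    simp only [mem_cell_leaf_iff (Set.mem_univ x : x ∈ p.cell []) hu]
  rw [Finset.sum_congr rfl this, Finset.sum_ite_eq, if_pos (leafFrom_mem_leavesFrom T x [])]

/-- If the time pruning at `l` has no node of length `k`, then it is a finite tree. -/
theorem exists_pruning {l : ℝ} {m : ℕ} {v : Node} (hv : p.birth v ≤ l)
    (h : ∀ w : Node, w.length = v.length + m → l < p.birth w) :
    ∃ T : BinTree, ∀ u ∈ T.leavesFrom v, p.IsLeafAt l u := by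
  induction m generalizing v with
  | zero => exact absurd hv (not_le.2 (h v rfl))
  | succ m ih =>
    by_cases hl : l < p.birth v + p.wait v
    · exact ⟨.leaf, by simp [BinTree.leavesFrom, TreePartition.IsLeafAt, hv, hl]⟩
    · have hc : ∀ a, ∃ T : BinTree, ∀ u ∈ T.leavesFrom (a :: v), p.IsLeafAt l u := fun a =>
        ih (v := a :: v) (not_lt.1 hl) fun w hw => h w (by simp at hw; omega)
      obtain ⟨T1, h1⟩ := hc false
      obtain ⟨T2, h2⟩ := hc true
      refine ⟨.split T1 T2, fun u hu => ?_⟩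
      rcases Finset.mem_union.1 hu with hu | hu
      exacts [h1 u hu, h2 u hu]

theorem exists_pruning_of_finite {l : ℝ} (hl : 0 ≤ l) (h : {v | p.birth v ≤ l}.Finite) :
    ∃ T : BinTree, ∀ u ∈ T.leavesFrom [], p.IsLeafAt l u := by
  obtain ⟨N, hN⟩ := (h.image List.length).bddAbove
  refine exists_pruning (m := N + 1) (v := []) hl fun w hw => ?_
  by_contra hc
  have := hN ⟨w, not_lt.1 hc, rfl⟩
  simp at hw
  omega

end Cells

/-! ### Measurability -/

section Measurability

variable {d : ℕ}

theorem measurable_coord (v : Node) : Measurable fun p : TreePartition d => p.coord v := by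
  unfold TreePartition.coord; fun_prop

theorem measurable_thr (v : Node) : Measurable fun p : TreePartition d => p.thr v := by
  unfold TreePartition.thr; fun_prop

theorem measurable_wait (v : Node) : Measurable fun p : TreePartition d => p.wait v := by
  unfold TreePartition.wait; fun_prop

theorem measurable_birth (v : Node) : Measurable fun p : TreePartition d => p.birth v := by
  induction v with
  | nil => exact measurable_const
  | cons a v ih => exact ih.add (measurable_wait v)

theorem measurableSet_le_thr (v : Node) :
    MeasurableSet {q : TreePartition d × Cube d | (q.2 (q.1.coord v) : ℝ) ≤ q.1.thr v} := by
  refine measurableSet_le ?_ ((measurable_thr v).comp measurable_fst)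
  exact measurable_eval_fin.comp (f := fun q : TreePartition d × Cube d =>
    ((fun j => (q.2 j : ℝ)), q.1.coord v))
    ((measurable_pi_iff.2 fun j => by fun_prop).prodMk ((measurable_coord v).comp measurable_fst))

theorem measurableSet_mem_cell (v : Node) :
    MeasurableSet {q : TreePartition d × Cube d | q.2 ∈ q.1.cell v} := by
  induction v with
  | nil => simp [TreePartition.cell]
  | cons a v ih =>
    cases a
    · simp only [mem_cell_false]
      exact ih.inter (measurableSet_le_thr v)
    · simp only [mem_cell_true]
      exact ih.inter (measurableSet_le_thr v).compl

theorem measurableSet_cell (p : TreePartition d) (v : Node) : MeasurableSet (p.cell v) :=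
  (measurableSet_mem_cell v).preimage (measurable_const.prodMk measurable_id : Measurable
    fun x : Cube d => (p, x))

theorem measurableSet_isLeafAt (l : ℝ) (v : Node) :
    MeasurableSet {p : TreePartition d | p.IsLeafAt l v} :=
  (measurableSet_le (measurable_birth v) measurable_const).inter
    (measurableSet_lt measurable_const ((measurable_birth v).add (measurable_wait v)))

theorem measurableSet_leafFrom_eq (T : BinTree) (v u : Node) :
    MeasurableSet {q : TreePartition d × Cube d | T.leafFrom q.1 q.2 v = u} := by
  induction T generalizing v with
  | leaf => simp only [BinTree.leafFrom]; exact MeasurableSet.const _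
  | split l r hl hr =>
    have : {q : TreePartition d × Cube d | (BinTree.split l r).leafFrom q.1 q.2 v = u} =
        Set.ite {q : TreePartition d × Cube d | (q.2 (q.1.coord v) : ℝ) ≤ q.1.thr v}
          {q | l.leafFrom q.1 q.2 (false :: v) = u} {q | r.leafFrom q.1 q.2 (true :: v) = u} := by
      ext q
      by_cases h : (q.2 (q.1.coord v) : ℝ) ≤ q.1.thr v <;> simp [Set.ite, BinTree.leafFrom, h]
    rw [this]
    exact (measurableSet_le_thr v).ite (hl _) (hr _)

theorem measurable_nodePred (v : Node) (t : ℕ) :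
    Measurable fun q : TreePartition d × (ℕ → Cube d × ℝ) => nodePred q.1 q.2 v t := by
  have hm : ∀ s, MeasurableSet {q : TreePartition d × (ℕ → Cube d × ℝ) | (q.2 s).1 ∈ q.1.cell v} :=
    fun s => (measurableSet_mem_cell v).preimage
      (by fun_prop : Measurable fun q : TreePartition d × (ℕ → Cube d × ℝ) => (q.1, (q.2 s).1))
  unfold nodePred
  simp only [Finset.sum_filter, Finset.card_filter]
  push_cast
  refine Measurable.div ?_ ?_
  · exact Finset.measurable_fun_sum _ fun s _ => Measurable.ite (hm s) (by fun_prop) measurable_const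
  · exact Finset.measurable_fun_sum _ fun s _ => Measurable.ite (hm s) measurable_const measurable_const

theorem measurable_treePred (T : BinTree) (t : ℕ) :
    Measurable fun q : (TreePartition d × (ℕ → Cube d × ℝ)) × Cube d =>
      treePred q.1.1 q.1.2 T t q.2 := by
  unfold treePred
  -- The leaf reached varies with the partition and the point, but ranges over the fixed finite set
  -- of leaves of `T`.
  have h : (fun q : (TreePartition d × (ℕ → Cube d × ℝ)) × Cube d =>
      nodePred q.1.1 q.1.2 (T.leafFrom q.1.1 q.2 []) t) = fun q => ∑ u ∈ T.leavesFrom [],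
        if T.leafFrom q.1.1 q.2 [] = u then nodePred q.1.1 q.1.2 u t else 0 := by
    ext q
    rw [Finset.sum_ite_eq, if_pos (leafFrom_mem_leavesFrom T _ [])]
  rw [h]
  refine Finset.measurable_fun_sum _ fun u _ => Measurable.ite ?_
    ((measurable_nodePred u t).comp measurable_fst) measurable_const
  exact (measurableSet_leafFrom_eq T [] u).preimage (by fun_prop :
    Measurable fun q : (TreePartition d × (ℕ → Cube d × ℝ)) × Cube d => (q.1.1, q.2))

theorem measurable_treeLoss (T : BinTree) (t : ℕ) :
    Measurable fun q : TreePartition d × (ℕ → Cube d × ℝ) => treeLoss q.1 q.2 T t := by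
  unfold treeLoss
  refine Finset.measurable_fun_sum _ fun s _ => Measurable.pow_const (Measurable.sub ?_ (by fun_prop)) 2
  exact (measurable_treePred T s).comp (by fun_prop :
    Measurable fun q : TreePartition d × (ℕ → Cube d × ℝ) => (q, (q.2 s).1))

/-- The unconditional sum is a sequential pointwise limit along the exhaustion by height. -/
theorem measurable_tsum_binTree {α : Type*} [MeasurableSpace α] {f : BinTree → α → ℝ}
    (hf : ∀ T, Measurable (f T)) (hs : ∀ a, Summable fun T => f T a) :
    Measurable fun a => ∑' T, f T a :=
  measurable_of_tendsto_metrizable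
    (fun k => Finset.measurable_fun_sum (BinTree.heightLT k) fun T _ => hf T)
    (tendsto_pi_nhds.2 fun a => (hs a).hasSum.comp BinTree.tendsto_heightLT)

theorem measurable_amf {η : ℝ} (hη : 0 ≤ η) (t : ℕ) :
    Measurable fun q : (TreePartition d × (ℕ → Cube d × ℝ)) × Cube d => amf η q.1.1 q.1.2 t q.2 := by
  have hw : ∀ T, Measurable fun q : (TreePartition d × (ℕ → Cube d × ℝ)) × Cube d =>
      treeWeight η q.1.1 q.1.2 t T := fun T =>
    (((measurable_treeLoss T t).comp measurable_fst).const_mul (-η)).exp.const_mul _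
  refine Measurable.div (measurable_tsum_binTree (fun T => (hw T).mul (measurable_treePred T t))
    fun q => ?_) (measurable_tsum_binTree hw fun q => summable_treeWeight hη t)
  -- No bound on the responses is available here; finitely many of them matter, and the sum of their
  -- absolute values serves as one.
  refine summable_treeWeight_mul_treePred (B := ∑ s ∈ Finset.range t, |(q.1.2 s).2|) hη
    (Finset.sum_nonneg fun _ _ => abs_nonneg _) (fun s hs => ?_) q.2
  exact Finset.single_le_sum (f := fun s => |(q.1.2 s).2|) (fun _ _ => abs_nonneg _)
    (Finset.mem_range.2 hs)

end Measurability

/-! ### Dependence on the past only -/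

section Past

variable {d : ℕ} {p : TreePartition d} {z : ℕ → Cube d × ℝ} {w : Cube d × ℝ}

theorem nodePred_update {t s : ℕ} (h : t ≤ s) (v : Node) :
    nodePred p (Function.update z s w) v t = nodePred p z v t := by
  unfold nodePred
  simp only [Finset.sum_filter, Finset.card_filter]
  have hne : ∀ i ∈ Finset.range t, Function.update z s w i = z i := fun i hi =>
    Function.update_of_ne (by have := Finset.mem_range.1 hi; omega) _ _
  congr 1
  · exact Finset.sum_congr rfl fun i hi => by rw [hne i hi]
  · congr 1
    exact Finset.sum_congr rfl fun i hi => by rw [hne i hi]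

theorem treePred_update {t s : ℕ} (h : t ≤ s) (T : BinTree) (x : Cube d) :
    treePred p (Function.update z s w) T t x = treePred p z T t x := nodePred_update h _

/-- Predictability: after `t` samples AMF does not see sample `t`, which is therefore fresh when the
risk is computed. -/
theorem amf_update {η : ℝ} {t s : ℕ} (h : t ≤ s) (x : Cube d) :
    amf η p (Function.update z s w) t x = amf η p z t x := by
  have hL : ∀ T, treeLoss p (Function.update z s w) T t = treeLoss p z T t := fun T => by
    unfold treeLoss
    refine Finset.sum_congr rfl fun i hi => ?_
    have hi := Finset.mem_range.1 hi
    rw [treePred_update (by omega), Function.update_of_ne (by omega)]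
  unfold amf treeWeight
  simp only [hL, treePred_update h]

end Past

/-! ### Resampling one coordinate of a product measure -/

section Resample

variable {ι X : Type*} [MeasurableSpace X] [DecidableEq ι] (Q : Measure X) [IsProbabilityMeasure Q]

/-- Replacing one coordinate by an independent copy preserves the product law. On a cylinder the
factor of coordinate `i` is supplied by the new variable instead of the old one. -/
theorem measurePreserving_update (i : ι) :
    MeasurePreserving (fun q : (ι → X) × X => Function.update q.1 i q.2)
      ((Measure.infinitePi fun _ : ι => Q).prod Q) (Measure.infinitePi fun _ : ι => Q) := by
  have hm : Measurable fun q : (ι → X) × X => Function.update q.1 i q.2 := by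
    refine measurable_pi_iff.2 fun j => ?_
    by_cases h : j = i
    · subst h; simpa using measurable_snd
    · simpa [Function.update_of_ne h] using by fun_prop
  refine ⟨hm, Measure.eq_infinitePi _ fun s t ht => ?_⟩
  rw [Measure.map_apply hm (MeasurableSet.pi s.countable_toSet fun j _ => ht j)]
  have : (fun q : (ι → X) × X => Function.update q.1 i q.2) ⁻¹' ((s : Set ι).pi t) =
      (((s.erase i : Finset ι) : Set ι).pi t) ×ˢ (if i ∈ s then t i else Set.univ) := by
    ext ⟨z, w⟩
    simp only [Set.mem_preimage, Set.mem_pi, Finset.mem_coe, Set.mem_prod, Finset.mem_erase]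
    constructor
    · intro h
      refine ⟨fun j hj => by simpa [hj.1] using h j hj.2, ?_⟩
      split_ifs with hi
      · simpa using h i hi
      · trivial
    · rintro ⟨h1, h2⟩ j hj
      by_cases hji : j = i
      · subst hji; simpa [hj] using h2
      · simpa [hji] using h1 j ⟨hji, hj⟩
  rw [this, Measure.prod_prod, Measure.infinitePi_pi _ fun j _ => ht j]
  split_ifs with hi
  · rw [Finset.prod_erase_mul s (fun j => Q (t j)) hi]
  · simp [Finset.erase_eq_of_notMem hi]

/-- Integration against a fresh coordinate. -/
theorem lintegral_fresh (i : ι) {f : (ι → X) → X → ℝ≥0∞} (hf : Measurable (Function.uncurry f))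
    (h : ∀ z w x, f (Function.update z i w) x = f z x) :
    ∫⁻ z, f z (z i) ∂(Measure.infinitePi fun _ : ι => Q) =
      ∫⁻ z, ∫⁻ w, f z w ∂Q ∂(Measure.infinitePi fun _ : ι => Q) := by
  have hm : Measurable fun z : ι → X => f z (z i) :=
    hf.comp (measurable_id.prodMk (measurable_pi_apply i))
  rw [← (measurePreserving_update Q i).lintegral_comp hm, lintegral_prod]
  · simp [h]
  · exact (hm.comp (measurePreserving_update Q i).measurable).aemeasurable

/-- A function that does not depend on a coordinate is independent of it. -/
theorem integral_mul_fresh (i : ι) {F : (ι → X) → ℝ} {h : X → ℝ} (hF : Measurable F)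
    (hh : Measurable h) (hu : ∀ z w, F (Function.update z i w) = F z) :
    ∫ z, F z * h (z i) ∂(Measure.infinitePi fun _ : ι => Q) =
      (∫ z, F z ∂(Measure.infinitePi fun _ : ι => Q)) * ∫ w, h w ∂Q := by
  have hm : Measurable fun z : ι → X => F z * h (z i) :=
    hF.mul (hh.comp (measurable_pi_apply i))
  have := (measurePreserving_update Q i).map_eq
  conv_lhs => rw [← this]
  rw [integral_map (measurePreserving_update Q i).measurable.aemeasurable hm.aestronglyMeasurable]
  simp only [hu, Function.update_self]
  exact integral_prod_mul F h

end Resample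

/-! ### Online estimation of a mean on a cell -/

section RunningMean

variable {X : Type*}

open Classical in
/-- The number of visits to `S` before time `t`. -/
noncomputable def visits (S : Set X) (z : ℕ → X) (t : ℕ) : ℕ :=
  ((Finset.range t).filter fun s => z s ∈ S).card

open Classical in
/-- The mean of the values `y` observed at the visits to `S` before time `t`. -/
noncomputable def runningMean (S : Set X) (y : X → ℝ) (z : ℕ → X) (t : ℕ) : ℝ :=
  (∑ s ∈ Finset.range t with z s ∈ S, y (z s)) / (visits S z t : ℝ)

theorem visits_zero (S : Set X) (z : ℕ → X) : visits S z 0 = 0 := by simp [visits]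

theorem visits_succ_of_mem {S : Set X} {z : ℕ → X} {t : ℕ} (h : z t ∈ S) :
    visits S z (t + 1) = visits S z t + 1 := by
  simp [visits, Finset.range_add_one, Finset.filter_insert, h]

theorem visits_succ_of_notMem {S : Set X} {z : ℕ → X} {t : ℕ} (h : z t ∉ S) :
    visits S z (t + 1) = visits S z t := by
  simp [visits, Finset.range_add_one, Finset.filter_insert, h]

theorem visits_le (S : Set X) (z : ℕ → X) (t : ℕ) : visits S z t ≤ t :=
  by
  classical
  unfold visits
  exact (Finset.card_filter_le _ _).trans (by simp)

theorem visits_update (S : Set X) (z : ℕ → X) (w : X) {s t : ℕ} (h : t ≤ s) :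
    visits S (Function.update z s w) t = visits S z t := by
  classical
  unfold visits
  congr 1
  refine Finset.filter_congr fun i hi => ?_
  rw [Function.update_of_ne (by have := Finset.mem_range.1 hi; omega)]

theorem sum_update_of_le (h : X → ℝ) (z : ℕ → X) (w : X) {s t : ℕ} (hst : t ≤ s) :
    ∑ i ∈ Finset.range t, h (Function.update z s w i) = ∑ i ∈ Finset.range t, h (z i) :=
  Finset.sum_congr rfl fun i hi => by
    rw [Function.update_of_ne (by have := Finset.mem_range.1 hi; omega)]

/-- Time change: at successive visits the earlier visit counts are `0, 1, 2, …`. A sum over time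
thus becomes a sum over the visit number, whatever the sample path. -/
theorem sum_indicator_visits (S : Set X) (ψ : ℕ → ℝ) (z : ℕ → X) (n : ℕ) :
    ∑ t ∈ Finset.range n, ψ (visits S z t) * S.indicator 1 (z t) =
      ∑ k ∈ Finset.range (visits S z n), ψ k := by
  induction n with
  | zero => simp [visits_zero]
  | succ n ih =>
    rw [Finset.sum_range_succ, ih]
    by_cases h : z n ∈ S
    · rw [visits_succ_of_mem h, Finset.sum_range_succ]; simp [h]
    · rw [visits_succ_of_notMem h]; simp [h]

/-- After `k ≥ 1` visits the error is the centred sum divided by `k`. With no visit the default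
prediction `0` has squared error `m ^ 2`, while `0⁻¹ = 0` kills the first term. -/
theorem runningMean_sub_eq {S : Set X} {y : X → ℝ} (m : ℝ) (z : ℕ → X) (t : ℕ) :
    (runningMean S y z t - m) ^ 2 =
      ((visits S z t : ℝ) ^ 2)⁻¹ *
        (∑ s ∈ Finset.range t, S.indicator (fun x => y x - m) (z s)) ^ 2 +
      (if visits S z t = 0 then m ^ 2 else 0) := by
  classical
  have h : ∑ s ∈ Finset.range t, S.indicator (fun x => y x - m) (z s) =
      (∑ s ∈ Finset.range t with z s ∈ S, y (z s)) - visits S z t * m := by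
    simp only [Set.indicator_apply, ← Finset.sum_filter, Finset.sum_sub_distrib, Finset.sum_const,
      nsmul_eq_mul, visits]
  rw [h, runningMean]
  by_cases h0 : visits S z t = 0
  · simp [h0]
  · have : (visits S z t : ℝ) ≠ 0 := by exact_mod_cast h0
    rw [if_neg h0]
    field_simp
    ring

theorem abs_runningMean_le {S : Set X} {y : X → ℝ} {B : ℝ} (hB : 0 ≤ B) {z : ℕ → X} {t : ℕ}
    (hz : ∀ s < t, |y (z s)| ≤ B) : |runningMean S y z t| ≤ B := by
  classical
  unfold runningMean visits
  set F := (Finset.range t).filter fun s => z s ∈ S with hF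
  have h : |∑ s ∈ F, y (z s)| ≤ F.card * B := by
    refine (Finset.abs_sum_le_sum_abs _ _).trans ?_
    rw [← nsmul_eq_mul]
    refine Finset.sum_le_card_nsmul _ _ _ fun s hs => hz s ?_
    simpa using (Finset.mem_filter.1 hs).1
  rcases F.card.eq_zero_or_pos with h0 | h0
  · simp [h0, hB]
  · rw [abs_div, Nat.abs_cast, div_le_iff₀ (by positivity)]
    linarith

theorem runningMean_update (S : Set X) (y : X → ℝ) (z : ℕ → X) (w : X) {s t : ℕ} (h : t ≤ s) :
    runningMean S y (Function.update z s w) t = runningMean S y z t := by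
  classical
  unfold runningMean
  rw [visits_update S z w h, Finset.sum_filter, Finset.sum_filter]
  congr 1
  refine Finset.sum_congr rfl fun i hi => ?_
  rw [Function.update_of_ne (by have := Finset.mem_range.1 hi; omega)]

variable [MeasurableSpace X]

theorem measurable_visits {S : Set X} (hS : MeasurableSet S) (t : ℕ) :
    Measurable fun z : ℕ → X => visits S z t := by
  unfold visits
  simp only [Finset.card_filter]
  exact Finset.measurable_fun_sum _ fun s _ =>
    Measurable.ite (hS.preimage (measurable_pi_apply s)) measurable_const measurable_const

variable {Q : Measure X} [IsProbabilityMeasure Q]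

theorem ae_infinitePi_forall {r : X → Prop} (h : ∀ᵐ x ∂Q, r x) :
    ∀ᵐ z ∂(Measure.infinitePi fun _ : ℕ => Q), ∀ s, r (z s) :=
  ae_all_iff.2 fun s => (measurePreserving_eval_infinitePi (fun _ : ℕ => Q) s).quasiMeasurePreserving.ae h

theorem integrable_visits_mul_pow {S : Set X} (hS : MeasurableSet S) {h : X → ℝ} (hm : Measurable h)
    {K : ℝ} (hK : ∀ᵐ x ∂Q, |h x| ≤ K) (φ : ℕ → ℝ) (t k : ℕ) :
    Integrable (fun z : ℕ → X => φ (visits S z t) * (∑ s ∈ Finset.range t, h (z s)) ^ k)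
      (Measure.infinitePi fun _ : ℕ => Q) := by
  refine Integrable.of_bound (C := (∑ i ∈ Finset.range (t + 1), |φ i|) * (t * K) ^ k) ?_ ?_
  · refine Measurable.aestronglyMeasurable (Measurable.mul ?_ ?_)
    · exact (measurable_of_countable φ).comp (measurable_visits hS t)
    · fun_prop
  · filter_upwards [ae_infinitePi_forall hK] with z hz
    rw [norm_mul, norm_pow, Real.norm_eq_abs, Real.norm_eq_abs]
    refine mul_le_mul ?_ (pow_le_pow_left₀ (abs_nonneg _) ?_ k) (by positivity)
      (Finset.sum_nonneg fun _ _ => abs_nonneg _)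
    · exact Finset.single_le_sum (f := fun i => |φ i|) (fun _ _ => abs_nonneg _)
        (Finset.mem_range.2 (Nat.lt_succ_of_le (visits_le S z t)))
    · refine (Finset.abs_sum_le_sum_abs _ _).trans ?_
      refine (Finset.sum_le_card_nsmul _ _ K fun s _ => hz s).trans (by simp)

theorem integrable_mul_fresh {F : (ℕ → X) → ℝ} (hF : Integrable F (Measure.infinitePi fun _ : ℕ => Q))
    {f : X → ℝ} (hf : Measurable f) {K : ℝ} (hK : ∀ᵐ x ∂Q, |f x| ≤ K) (t : ℕ) :
    Integrable (fun z => F z * f (z t)) (Measure.infinitePi fun _ : ℕ => Q) := by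
  refine hF.mul_bdd (c := K) (hf.comp (measurable_pi_apply t)).aestronglyMeasurable ?_
  filter_upwards [ae_infinitePi_forall hK] with z hz using hz t

/-- Centred sums stopped on a visit count have the variance of independent sums. -/
theorem integral_visits_mul_sq {S : Set X} (hS : MeasurableSet S) {h : X → ℝ} (hm : Measurable h)
    {K : ℝ} (hK : ∀ᵐ x ∂Q, |h x| ≤ K) (hSc : ∀ x ∉ S, h x = 0) (h0 : ∫ x, h x ∂Q = 0)
    (t : ℕ) (φ : ℕ → ℝ) :
    Q.real S * ∫ z, φ (visits S z t) * (∑ s ∈ Finset.range t, h (z s)) ^ 2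
        ∂(Measure.infinitePi fun _ : ℕ => Q) =
      (∫ x, h x ^ 2 ∂Q) * ∫ z, φ (visits S z t) * visits S z t
        ∂(Measure.infinitePi fun _ : ℕ => Q) := by
  -- A visit shifts the count by one, so the induction hypothesis is needed for both `φ` and `fun k
  -- => φ (k + 1)`.
  induction t generalizing φ with
  | zero => simp [visits_zero]
  | succ t ih =>
    have hvm := measurable_visits hS t
    have hi1 : Measurable (S.indicator (1 : X → ℝ)) := measurable_one.indicator hS
    have hi2 : Measurable (Sᶜ.indicator (1 : X → ℝ)) := measurable_one.indicator hS.compl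
    have hb : ∀ A : Set X, ∀ᵐ x ∂Q, |A.indicator (1 : X → ℝ) x| ≤ 1 := fun A =>
      .of_forall fun x => by by_cases hx : x ∈ A <;> simp [hx]
    have hφm : ∀ φ : ℕ → ℝ, Measurable fun z : ℕ → X => φ (visits S z t) := fun φ =>
      (measurable_of_countable φ).comp hvm
    have hDm : Measurable fun z : ℕ → X => ∑ s ∈ Finset.range t, h (z s) := by fun_prop
    have hFm : ∀ (φ : ℕ → ℝ) (k : ℕ), Measurable fun z : ℕ → X =>
        φ (visits S z t) * (∑ s ∈ Finset.range t, h (z s)) ^ k := fun φ k =>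
      (hφm φ).mul (hDm.pow_const k)
    have hint := fun φ : ℕ → ℝ => fun k => integrable_visits_mul_pow hS hm hK φ t k
    have hint0 : ∀ φ : ℕ → ℝ, Integrable (fun z : ℕ → X => φ (visits S z t))
        (Measure.infinitePi fun _ : ℕ => Q) := fun φ => by simpa using hint φ 0
    have hh2 : ∀ᵐ x ∂Q, |h x ^ 2| ≤ K ^ 2 := by
      filter_upwards [hK] with x hx
      rw [abs_pow]; exact pow_le_pow_left₀ (abs_nonneg _) hx 2
    have hvu := fun z w => visits_update S z w (le_refl t)
    have hDu := fun z w => sum_update_of_le h z w (le_refl t)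
    -- Split on whether the fresh sample falls in `S`. The cross term has mean zero by independence
    -- and `h0`; the terms in `h (z t)` need no indicator because `h` vanishes off `S`.
    have e1 : ∀ z : ℕ → X, φ (visits S z (t + 1)) * (∑ s ∈ Finset.range (t + 1), h (z s)) ^ 2 =
        φ (visits S z t) * (∑ s ∈ Finset.range t, h (z s)) ^ 2 * Sᶜ.indicator 1 (z t) +
        φ (visits S z t + 1) * (∑ s ∈ Finset.range t, h (z s)) ^ 2 * S.indicator 1 (z t) +
        2 * (φ (visits S z t + 1) * (∑ s ∈ Finset.range t, h (z s)) ^ 1 * h (z t)) +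
        φ (visits S z t + 1) * h (z t) ^ 2 := by
      intro z
      rw [Finset.sum_range_succ]
      by_cases hz : z t ∈ S
      · rw [visits_succ_of_mem hz]; simp [hz]; ring
      · rw [visits_succ_of_notMem hz]; simp [hz, hSc _ hz]
    have e2 : ∀ z : ℕ → X, φ (visits S z (t + 1)) * (visits S z (t + 1) : ℝ) =
        φ (visits S z t) * (visits S z t : ℝ) * Sᶜ.indicator 1 (z t) +
        φ (visits S z t + 1) * (visits S z t : ℝ) * S.indicator 1 (z t) +
        φ (visits S z t + 1) * S.indicator 1 (z t) := by
      intro z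
      by_cases hz : z t ∈ S
      · rw [visits_succ_of_mem hz]; simp [hz]; ring
      · rw [visits_succ_of_notMem hz]; simp [hz]
    have i1 := integrable_mul_fresh (hint φ 2) hi2 (hb _) t
    have i2 := integrable_mul_fresh (hint (fun k => φ (k + 1)) 2) hi1 (hb _) t
    have i3 := (integrable_mul_fresh (hint (fun k => φ (k + 1)) 1) hm hK t).const_mul 2
    have i4 := integrable_mul_fresh (hint0 (fun k => φ (k + 1))) (hm.pow_const 2) hh2 t
    have j1 := integrable_mul_fresh (hint0 fun k => φ k * (k : ℝ)) hi2 (hb _) t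
    have j2 := integrable_mul_fresh (hint0 fun k => φ (k + 1) * (k : ℝ)) hi1 (hb _) t
    have j3 := integrable_mul_fresh (hint0 fun k => φ (k + 1)) hi1 (hb _) t
    have q1 : ∫ x, S.indicator (1 : X → ℝ) x ∂Q = Q.real S := integral_indicator_one hS
    have q2 : ∫ x, Sᶜ.indicator (1 : X → ℝ) x ∂Q = 1 - Q.real S := by
      rw [integral_indicator_one hS.compl, probReal_compl_eq_one_sub hS]
    simp only [e1, e2]
    rw [integral_add ((i1.fun_add i2).fun_add i3) i4, integral_add (i1.fun_add i2) i3, integral_add i1 i2,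
      integral_const_mul,
      integral_mul_fresh Q t (hFm φ 2) hi2 (fun z w => by simp only [hvu, hDu]),
      integral_mul_fresh Q t (hFm (fun k => φ (k + 1)) 2) hi1
        (fun z w => by simp only [hvu, hDu]),
      integral_mul_fresh Q t (hFm (fun k => φ (k + 1)) 1) hm
        (fun z w => by simp only [hvu, hDu]),
      integral_mul_fresh Q t (hφm fun k => φ (k + 1)) (hm.pow_const 2)
        (fun z w => by simp only [hvu]),
      integral_add (j1.fun_add j2) j3, integral_add j1 j2,
      integral_mul_fresh Q t (hφm fun k => φ k * (k : ℝ)) hi2 (fun z w => by simp only [hvu]),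
      integral_mul_fresh Q t (hφm fun k => φ (k + 1) * (k : ℝ)) hi1 (fun z w => by simp only [hvu]),
      integral_mul_fresh Q t (hφm fun k => φ (k + 1)) hi1 (fun z w => by simp only [hvu]),
      q1, q2, h0]
    have ih1 := ih φ
    have ih2 := ih fun k => φ (k + 1)
    linear_combination (1 - Q.real S) * ih1 + Q.real S * ih2

theorem measurable_runningMean {S : Set X} (hS : MeasurableSet S) {y : X → ℝ} (hy : Measurable y)
    (t : ℕ) : Measurable fun z : ℕ → X => runningMean S y z t := by
  unfold runningMean
  simp only [Finset.sum_filter]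
  refine Measurable.div (Finset.measurable_fun_sum _ fun s _ => Measurable.ite
    (hS.preimage (measurable_pi_apply s)) (by fun_prop) measurable_const) ?_
  exact (measurable_of_countable (fun k : ℕ => (k : ℝ))).comp (measurable_visits hS t)

/-- The expected loss of the running mean at one step. -/
theorem integral_runningMean_loss {S : Set X} (hS : MeasurableSet S) {y : X → ℝ} (hy : Measurable y)
    {B : ℝ} (hB : 0 ≤ B) (hyB : ∀ᵐ x ∂Q, |y x| ≤ B) {m v : ℝ}
    (hm : ∫ x, S.indicator (fun x => y x - m) x ∂Q = 0)
    (hv : ∫ x, S.indicator (fun x => y x - m) x ^ 2 ∂Q = v * Q.real S) (t : ℕ) :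
    ∫ z, S.indicator (fun x => (runningMean S y z t - y x) ^ 2) (z t)
        ∂(Measure.infinitePi fun _ : ℕ => Q) =
      v * Q.real S + ∫ z, (((visits S z t : ℝ) ^ 2)⁻¹ * visits S z t * v +
        if visits S z t = 0 then m ^ 2 else 0) * S.indicator 1 (z t)
          ∂(Measure.infinitePi fun _ : ℕ => Q) := by
  set h : X → ℝ := S.indicator fun x => y x - m with hh
  have hhm : Measurable h := (hy.sub_const m).indicator hS
  have hhK : ∀ᵐ x ∂Q, |h x| ≤ B + |m| := by
    filter_upwards [hyB] with x hx
    by_cases hxS : x ∈ S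
    · simp only [hh, Set.indicator_of_mem hxS]
      exact (abs_sub _ _).trans (by linarith)
    · simp only [hh, Set.indicator_of_notMem hxS]
      simp; positivity
  have hh2 : ∀ᵐ x ∂Q, |h x ^ 2| ≤ (B + |m|) ^ 2 := by
    filter_upwards [hhK] with x hx
    rw [abs_pow]; exact pow_le_pow_left₀ (abs_nonneg _) hx 2
  have hi1 : Measurable (S.indicator (1 : X → ℝ)) := measurable_one.indicator hS
  have hb : ∀ᵐ x ∂Q, |S.indicator (1 : X → ℝ) x| ≤ 1 :=
    .of_forall fun x => by by_cases hx : x ∈ S <;> simp [hx]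
  have hvm := measurable_visits hS t
  have hrm : Measurable fun z : ℕ → X => runningMean S y z t - m :=
    (measurable_runningMean hS hy t).sub_const m
  have hrb : ∀ᵐ z ∂(Measure.infinitePi fun _ : ℕ => Q), |runningMean S y z t - m| ≤ B + |m| := by
    filter_upwards [ae_infinitePi_forall hyB] with z hz
    exact (abs_sub _ _).trans (by linarith [abs_runningMean_le (S := S) hB (t := t) fun s _ => hz s])
  have hri : Integrable (fun z : ℕ → X => runningMean S y z t - m)
      (Measure.infinitePi fun _ : ℕ => Q) := .of_bound hrm.aestronglyMeasurable (B + |m|) hrb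
  have hri2 : Integrable (fun z : ℕ → X => (runningMean S y z t - m) ^ 2)
      (Measure.infinitePi fun _ : ℕ => Q) := by
    refine .of_bound (hrm.pow_const 2).aestronglyMeasurable ((B + |m|) ^ 2) ?_
    filter_upwards [hrb] with z hz
    rw [Real.norm_eq_abs, abs_pow]; exact pow_le_pow_left₀ (abs_nonneg _) hz 2
  have hru := fun z w => runningMean_update S y z w (le_refl t)
  have hvu := fun z w => visits_update S z w (le_refl t)
  -- Bias–variance decomposition around `m`. The cross term has zero mean because the running mean
  -- depends on earlier samples only.
  have e1 : ∀ z : ℕ → X, S.indicator (fun x => (runningMean S y z t - y x) ^ 2) (z t) =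
      (runningMean S y z t - m) ^ 2 * S.indicator 1 (z t) +
      (-2) * ((runningMean S y z t - m) * h (z t)) + 1 * h (z t) ^ 2 := by
    intro z
    by_cases hz : z t ∈ S
    · simp [hh, hz]; ring
    · simp [hh, hz]
  have i1 := integrable_mul_fresh hri2 hi1 hb t
  have i2 := (integrable_mul_fresh hri hhm hhK t).const_mul (-2)
  have i3 := integrable_mul_fresh (integrable_const (1 : ℝ)
    (μ := Measure.infinitePi fun _ : ℕ => Q)) (hhm.pow_const 2) hh2 t
  simp only [e1]
  have q1 : ∫ x, S.indicator (1 : X → ℝ) x ∂Q = Q.real S := integral_indicator_one hS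
  set ψ : ℕ → ℝ := fun k => ((k : ℝ) ^ 2)⁻¹ * k * v + if k = 0 then m ^ 2 else 0 with hψ
  have hψm : Measurable fun z : ℕ → X => ψ (visits S z t) := (measurable_of_countable ψ).comp hvm
  rw [integral_add (i1.fun_add i2) i3, integral_add i1 i2, integral_const_mul,
    integral_mul_fresh Q t (hrm.pow_const 2) hi1 (fun z w => by simp only [hru]),
    integral_mul_fresh Q t hrm hhm (fun z w => by simp only [hru]),
    integral_mul_fresh Q t measurable_const (hhm.pow_const 2) (fun z w => rfl),
    integral_mul_fresh Q t hψm hi1 (fun z w => by simp only [hvu]), hm, hv, q1]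
  have hint := fun φ : ℕ → ℝ => fun k => integrable_visits_mul_pow hS hhm hhK φ t k
  -- The weight `1 / k ^ 2` turns the variance `k * v` of a centred sum over `k` visits into `v /
  -- k`.
  have key := integral_visits_mul_sq hS hhm hhK (fun x hx => by simp [hh, hx]) hm t
    fun k => ((k : ℝ) ^ 2)⁻¹
  have k0 : Integrable (fun z : ℕ → X => if visits S z t = 0 then m ^ 2 else 0)
      (Measure.infinitePi fun _ : ℕ => Q) := by
    simpa using hint (fun k => if k = 0 then m ^ 2 else 0) 0
  have k1 : Integrable (fun z : ℕ → X => ((visits S z t : ℝ) ^ 2)⁻¹ * visits S z t)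
      (Measure.infinitePi fun _ : ℕ => Q) := by
    simpa using hint (fun k => ((k : ℝ) ^ 2)⁻¹ * k) 0
  simp only [runningMean_sub_eq, hψ]
  rw [integral_add (hint (fun k => ((k : ℝ) ^ 2)⁻¹) 2) k0, integral_add (k1.mul_const v) k0,
    integral_mul_const]
  rw [hv] at key
  simp only [integral_const, probReal_univ, one_smul]
  linear_combination key

/-- The regret of the running mean on a cell against a constant, in expectation. -/
theorem sum_integral_runningMean_loss_le {S : Set X} (hS : MeasurableSet S) {y : X → ℝ}
    (hy : Measurable y) {B : ℝ} (hB : 0 ≤ B) (hyB : ∀ᵐ x ∂Q, |y x| ≤ B) {n : ℕ} (hn : 2 ≤ n) (c : ℝ) :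
    ∑ t ∈ Finset.range n, ∫ z, S.indicator (fun x => (runningMean S y z t - y x) ^ 2) (z t)
        ∂(Measure.infinitePi fun _ : ℕ => Q) ≤
      n * ∫ x in S, (c - y x) ^ 2 ∂Q + B ^ 2 * harmonic (n - 1) := by
  set q := Q.real S with hq
  have hyI : Integrable y Q := .of_bound hy.aestronglyMeasurable B hyB
  have hy2I : Integrable (fun x => y x ^ 2) Q := by
    refine .of_bound (hy.pow_const 2).aestronglyMeasurable (B ^ 2) ?_
    filter_upwards [hyB] with x hx
    rw [Real.norm_eq_abs, abs_pow]; exact pow_le_pow_left₀ (abs_nonneg _) hx 2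
  have hsq : ∀ a : ℝ, ∫ x in S, (a - y x) ^ 2 ∂Q =
      a ^ 2 * q - 2 * a * ∫ x in S, y x ∂Q + ∫ x in S, y x ^ 2 ∂Q := by
    intro a
    have : ∀ x, (a - y x) ^ 2 = a ^ 2 - 2 * a * y x + y x ^ 2 := fun x => by ring
    simp only [this]
    have hI : Integrable (fun x => a ^ 2 - 2 * a * y x) (Q.restrict S) :=
      (integrable_const _).sub (hyI.integrableOn.const_mul _)
    rw [integral_add hI hy2I.integrableOn,
      integral_sub (integrable_const _) (hyI.integrableOn.const_mul _), integral_const_mul]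
    simp [hq, mul_comm]
  -- `m` and `v` are the conditional mean and variance on `S`. If `q = 0` both are `0` by the
  -- division convention, and the identities multiplied by `q` still hold.
  set m := (∫ x in S, y x ∂Q) / q with hmd
  have hmq : ∫ x in S, y x ∂Q = m * q := by
    by_cases h0 : q = 0
    · have : Q S = 0 := by rwa [hq, measureReal_eq_zero_iff] at h0
      rw [Measure.restrict_eq_zero.2 this]; simp [h0]
    · rw [hmd, div_mul_cancel₀ _ h0]
  set v := (∫ x in S, (m - y x) ^ 2 ∂Q) / q with hvd
  have hvq : ∫ x in S, (m - y x) ^ 2 ∂Q = v * q := by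
    by_cases h0 : q = 0
    · have : Q S = 0 := by rwa [hq, measureReal_eq_zero_iff] at h0
      rw [Measure.restrict_eq_zero.2 this]; simp [h0]
    · rw [hvd, div_mul_cancel₀ _ h0]
  have hq0 : 0 ≤ q := measureReal_nonneg
  have hv0 : 0 ≤ v := div_nonneg (integral_nonneg fun _ => sq_nonneg _) hq0
  have h1 : ∫ x, S.indicator (fun x => y x - m) x ∂Q = 0 := by
    rw [integral_indicator hS, integral_sub hyI.integrableOn (integrable_const _), hmq]
    simp [hq, mul_comm]
  have h2 : ∫ x, S.indicator (fun x => y x - m) x ^ 2 ∂Q = v * q := by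
    rw [← hvq, ← integral_indicator hS]
    congr with x
    by_cases hx : x ∈ S
    · simp [hx]; ring
    · simp [hx]
  have hvm : q * (v + m ^ 2) ≤ q * B ^ 2 := by
    have e : q * (v + m ^ 2) = ∫ x in S, y x ^ 2 ∂Q := by
      have := hsq m
      rw [hvq, hmq] at this
      linear_combination this
    rw [e]
    have : ∫ x in S, y x ^ 2 ∂Q ≤ ∫ x in S, B ^ 2 ∂Q := by
      refine integral_mono_ae hy2I.integrableOn (integrable_const _) (ae_restrict_of_ae ?_)
      filter_upwards [hyB] with x hx
      exact sq_le_sq' (by linarith [(abs_le.1 hx).1]) (abs_le.1 hx).2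
    simpa [hq] using this
  have hvmB : v + m ^ 2 ≤ B ^ 2 := by
    rcases hq0.eq_or_lt with h0 | h0
    · have hm0 : m = 0 := by rw [hmd, ← h0, div_zero]
      have hv0 : v = 0 := by rw [hvd, ← h0, div_zero]
      simpa [hm0, hv0] using sq_nonneg B
    · exact le_of_mul_le_mul_left hvm h0
  set ψ : ℕ → ℝ := fun k => ((k : ℝ) ^ 2)⁻¹ * k * v + if k = 0 then m ^ 2 else 0 with hψ
  have hψ0 : ∀ k, 0 ≤ ψ k := fun k => by
    refine add_nonneg (by positivity) ?_
    split_ifs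
    exacts [sq_nonneg m, le_rfl]
  -- The sum is `m ^ 2 + v * harmonic (n - 1)`. As `n ≥ 2`, the harmonic number is at least `1` and
  -- absorbs the cost `m ^ 2` of the first visit, leaving `v + m ^ 2 ≤ B ^ 2` as the factor.
  have hψs : ∑ k ∈ Finset.range n, ψ k ≤ B ^ 2 * harmonic (n - 1) := by
    obtain ⟨k, rfl⟩ : ∃ k, n = k + 1 + 1 := ⟨n - 2, by omega⟩
    rw [Finset.sum_range_succ', Nat.add_sub_cancel, harmonic]
    push_cast
    have : ∀ i : ℕ, ψ (i + 1) = v * ((i : ℝ) + 1)⁻¹ := fun i => by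
      simp only [hψ, Nat.add_eq_zero_iff, one_ne_zero, and_false, if_false]; push_cast
      field_simp
      ring
    simp only [this, ← Finset.mul_sum]
    have h00 : ψ 0 = m ^ 2 := by simp [hψ]
    rw [h00]
    have : 1 ≤ ∑ i ∈ Finset.range (k + 1), ((i : ℝ) + 1)⁻¹ := by
      rw [Finset.sum_range_succ']
      have : 0 ≤ ∑ i ∈ Finset.range k, (((i + 1 : ℕ) : ℝ) + 1)⁻¹ :=
        Finset.sum_nonneg fun _ _ => by positivity
      simp at *; linarith
    nlinarith [sq_nonneg m]
  have hψm : ∀ t, Measurable fun z : ℕ → X => ψ (visits S z t) := fun t =>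
    (measurable_of_countable ψ).comp (measurable_visits hS t)
  have hψi : ∀ t, Integrable (fun z : ℕ → X => ψ (visits S z t) * S.indicator 1 (z t))
      (Measure.infinitePi fun _ : ℕ => Q) := fun t => by
    refine integrable_mul_fresh ?_ (measurable_one.indicator hS) (K := 1)
      (.of_forall fun x => by by_cases hx : x ∈ S <;> simp [hx]) t
    -- With exponent `0`, the factor coming from the zero function is `1`.
    simpa using integrable_visits_mul_pow hS measurable_const (Q := Q) (h := fun _ => 0) (K := 0)
      (.of_forall fun x => by simp) ψ t 0
  have hmain : ∑ t ∈ Finset.range n, ∫ z, S.indicator (fun x => (runningMean S y z t - y x) ^ 2) (z t)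
        ∂(Measure.infinitePi fun _ : ℕ => Q) ≤ n * (v * q) + B ^ 2 * harmonic (n - 1) := by
    simp only [integral_runningMean_loss hS hy hB hyB h1 h2]
    rw [Finset.sum_add_distrib, Finset.sum_const, Finset.card_range, nsmul_eq_mul,
      ← integral_finsetSum _ fun t _ => hψi t]
    gcongr
    refine le_trans ?_ hψs
    have : ∀ z : ℕ → X, ∑ t ∈ Finset.range n, ψ (visits S z t) * S.indicator 1 (z t) ≤
        ∑ k ∈ Finset.range n, ψ k := fun z => by
      rw [sum_indicator_visits]
      exact Finset.sum_le_sum_of_subset_of_nonneg (Finset.range_mono (visits_le S z n))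
        fun k _ _ => hψ0 k
    refine (integral_mono (integrable_finsetSum _ fun t _ => hψi t) (integrable_const _) this).trans ?_
    simp
  refine hmain.trans ?_
  gcongr
  have h3 := hsq c
  have h4 := hsq m
  rw [hvq] at h4
  rw [hmq] at h3 h4
  nlinarith [mul_nonneg hq0 (sq_nonneg (c - m))]

end RunningMean

/-! ### The cumulative risk of AMF on a fixed partition -/

section FixedPartition

variable {d : ℕ} {B : ℝ} {P : Measure (Cube d × ℝ)} [IsProbabilityMeasure P] {p : TreePartition d}

theorem nodePred_eq_runningMean (z : ℕ → Cube d × ℝ) (v : Node) (t : ℕ) :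
    nodePred p z v t = runningMean (Prod.fst ⁻¹' p.cell v) Prod.snd z t := rfl

/-- Each round is charged to the unique leaf containing its input, so the tree's loss splits into
separate running-mean problems. -/
theorem treeLoss_eq_sum_leaves (z : ℕ → Cube d × ℝ) (T : BinTree) (n : ℕ) :
    treeLoss p z T n = ∑ u ∈ T.leavesFrom [], ∑ t ∈ Finset.range n,
      (Prod.fst ⁻¹' p.cell u).indicator (fun x => (runningMean (Prod.fst ⁻¹' p.cell u) Prod.snd z t
        - x.2) ^ 2) (z t) := by
  classical
  rw [Finset.sum_comm]
  refine Finset.sum_congr rfl fun t _ => ?_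
  simp only [treePred, ← nodePred_eq_runningMean]
  rw [← sum_leaves_ite (p := p) T (z t).1 fun u => (nodePred p z u t - (z t).2) ^ 2]
  refine Finset.sum_congr rfl fun u _ => ?_
  simp only [Set.indicator_apply, Set.mem_preimage]

theorem integrable_runningMean_loss (hB : 0 ≤ B) (hP : ∀ᵐ z ∂P, |z.2| ≤ B)
    {S : Set (Cube d × ℝ)} (hS : MeasurableSet S) (t : ℕ) :
    Integrable (fun z : ℕ → Cube d × ℝ => S.indicator (fun x => (runningMean S Prod.snd z t
        - x.2) ^ 2) (z t)) (Measure.infinitePi fun _ : ℕ => P) := by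
  have e : (fun z : ℕ → Cube d × ℝ => S.indicator (fun x => (runningMean S Prod.snd z t
        - x.2) ^ 2) (z t)) = ((fun z : ℕ → Cube d × ℝ => z t) ⁻¹' S).indicator
          fun z => (runningMean S Prod.snd z t - (z t).2) ^ 2 := by
    ext z
    by_cases hz : z t ∈ S <;> simp [hz]
  rw [e]
  refine Integrable.indicator ?_ (hS.preimage (measurable_pi_apply t))
  refine .of_bound (C := (2 * B) ^ 2) (Measurable.aestronglyMeasurable ?_) ?_
  · exact ((measurable_runningMean hS measurable_snd t).sub (by fun_prop)).pow_const 2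
  · filter_upwards [ae_infinitePi_forall hP] with z hz
    rw [norm_pow]
    refine pow_le_pow_left₀ (norm_nonneg _) ((abs_sub _ _).trans ?_) 2
    linarith [hz t, abs_runningMean_le (S := S) (y := Prod.snd) hB (t := t) fun s _ => hz s]

theorem integral_treeLoss_le (hB : 0 ≤ B) (hP : ∀ᵐ z ∂P, |z.2| ≤ B) (T : BinTree) (c : Node → ℝ)
    {n : ℕ} (hn : 2 ≤ n) :
    ∫ z, treeLoss p z T n ∂(Measure.infinitePi fun _ : ℕ => P) ≤
      n * ∑ u ∈ T.leavesFrom [], ∫ x in Prod.fst ⁻¹' p.cell u, (c u - x.2) ^ 2 ∂P +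
        (T.leavesFrom []).card * (B ^ 2 * harmonic (n - 1)) := by
  have hS : ∀ u, MeasurableSet (Prod.fst ⁻¹' p.cell u : Set (Cube d × ℝ)) := fun u =>
    (measurableSet_cell p u).preimage measurable_fst
  simp only [treeLoss_eq_sum_leaves]
  rw [integral_finsetSum _ fun u _ => integrable_finsetSum _ fun t _ =>
    integrable_runningMean_loss hB hP (hS u) t, Finset.mul_sum, ← nsmul_eq_mul, ← Finset.sum_const,
    ← Finset.sum_add_distrib]
  refine Finset.sum_le_sum fun u _ => ?_
  rw [integral_finsetSum _ fun t _ => integrable_runningMean_loss hB hP (hS u) t]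
  exact sum_integral_runningMean_loss_le (hS u) measurable_snd hB hP hn (c u)

/-- The leaf cells partition the cube and `g` equals `c u` on the cell of `u`, so the two sides
agree leaf by leaf; only this direction is needed. -/
theorem sum_leaves_le_risk (hP : ∀ᵐ z ∂P, |z.2| ≤ B) (T : BinTree) {c : Node → ℝ}
    {g : Cube d → ℝ} (hg : Measurable g)
    (hc : ∀ u ∈ T.leavesFrom [], ∀ x ∈ p.cell u, g x = c u) :
    ENNReal.ofReal (∑ u ∈ T.leavesFrom [], ∫ x in Prod.fst ⁻¹' p.cell u, (c u - x.2) ^ 2 ∂P) ≤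
      risk P g := by
  classical
  have hS : ∀ u, MeasurableSet (Prod.fst ⁻¹' p.cell u : Set (Cube d × ℝ)) := fun u =>
    (measurableSet_cell p u).preimage measurable_fst
  have hm : Measurable fun z : Cube d × ℝ => ENNReal.ofReal ((g z.1 - z.2) ^ 2) := by fun_prop
  have e : ∀ z : Cube d × ℝ, ENNReal.ofReal ((g z.1 - z.2) ^ 2) = ∑ u ∈ T.leavesFrom [],
      (Prod.fst ⁻¹' p.cell u).indicator (fun z => ENNReal.ofReal ((g z.1 - z.2) ^ 2)) z := fun z => by
    rw [← sum_leaves_ite (p := p) T z.1 fun _ => ENNReal.ofReal ((g z.1 - z.2) ^ 2)]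
    simp only [Set.indicator_apply, Set.mem_preimage]
  rw [risk, lintegral_congr e, lintegral_finsetSum _ fun u _ => hm.indicator (hS u),
    ENNReal.ofReal_sum_of_nonneg fun u _ => integral_nonneg fun _ => sq_nonneg _]
  refine Finset.sum_le_sum fun u hu => le_of_eq ?_
  rw [lintegral_indicator (hS u), setLIntegral_congr_fun (hS u)
    (g := fun z => ENNReal.ofReal ((c u - z.2) ^ 2)) fun z hz => by simp only [hc u hu z.1 hz]]
  refine ofReal_integral_eq_lintegral_ofReal ?_ (.of_forall fun _ => sq_nonneg _)
  refine Integrable.integrableOn (.of_bound (C := (|c u| + B) ^ 2)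
    (by fun_prop : Measurable fun z : Cube d × ℝ => (c u - z.2) ^ 2).aestronglyMeasurable ?_)
  filter_upwards [hP] with z hz
  rw [norm_pow]
  exact pow_le_pow_left₀ (norm_nonneg _) ((abs_sub _ _).trans (by linarith)) 2

theorem risk_amf_le {η : ℝ} (hη : 0 ≤ η) (hB : 0 ≤ B) (hP : ∀ᵐ z ∂P, |z.2| ≤ B) (t : ℕ)
    {z : ℕ → Cube d × ℝ} (hz : ∀ s < t, |(z s).2| ≤ B) :
    risk P (amf η p z t) ≤ ENNReal.ofReal (4 * B ^ 2) := by
  have : ∫⁻ _ : Cube d × ℝ, ENNReal.ofReal (4 * B ^ 2) ∂P = ENNReal.ofReal (4 * B ^ 2) := by simp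
  rw [← this]
  refine lintegral_mono_ae ?_
  filter_upwards [hP] with w hw
  refine ENNReal.ofReal_le_ofReal ?_
  have h1 := abs_le.1 (abs_amf_le (p := p) hη hB hz w.1)
  have h2 := abs_le.1 hw
  nlinarith

theorem risk_amf_zero_le {η : ℝ} (hP : ∀ᵐ z ∂P, |z.2| ≤ B) (z : ℕ → Cube d × ℝ) :
    risk P (amf η p z 0) ≤ ENNReal.ofReal (B ^ 2) := by
  have : ∫⁻ _ : Cube d × ℝ, ENNReal.ofReal (B ^ 2) ∂P = ENNReal.ofReal (B ^ 2) := by simp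
  rw [← this]
  refine lintegral_mono_ae ?_
  filter_upwards [hP] with w hw
  refine ENNReal.ofReal_le_ofReal ?_
  have h0 : amf η p z 0 w.1 = 0 := by simp [amf, treePred, nodePred]
  rw [h0, zero_sub, neg_sq]
  exact sq_le_sq' (by linarith [(abs_le.1 hw).1]) (abs_le.1 hw).2

/-- Trivial bound: `B ^ 2` for the initial prediction `0`, and `(2 * B) ^ 2` for each of the other
`n - 1` predictors. It gives finiteness of the risk and handles small `n`. -/
theorem sum_lintegral_risk_amf_le {η : ℝ} (hη : 0 ≤ η) (hB : 0 ≤ B) (hP : ∀ᵐ z ∂P, |z.2| ≤ B)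
    {n : ℕ} (hn : 1 ≤ n) :
    ∑ t ∈ Finset.range n, ∫⁻ z, risk P (amf η p z t) ∂(Measure.infinitePi fun _ : ℕ => P) ≤
      ENNReal.ofReal ((4 * n - 3) * B ^ 2) := by
  obtain ⟨n, rfl⟩ : ∃ k, n = k + 1 := ⟨n - 1, by omega⟩
  rw [Finset.sum_range_succ']
  have h0 : ∫⁻ z, risk P (amf η p z 0) ∂(Measure.infinitePi fun _ : ℕ => P) ≤
      ENNReal.ofReal (B ^ 2) :=
    (lintegral_mono fun z => risk_amf_zero_le hP z).trans (by simp)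
  have h1 : ∀ t, ∫⁻ z, risk P (amf η p z t) ∂(Measure.infinitePi fun _ : ℕ => P) ≤
      ENNReal.ofReal (4 * B ^ 2) := fun t => by
    refine (lintegral_mono_ae (g := fun _ => ENNReal.ofReal (4 * B ^ 2)) ?_).trans (by simp)
    filter_upwards [ae_infinitePi_forall hP] with z hz
    exact risk_amf_le hη hB hP t fun s _ => hz s
  refine (add_le_add (Finset.sum_le_sum fun t _ => h1 (t + 1)) h0).trans (le_of_eq ?_)
  rw [Finset.sum_const, nsmul_eq_mul, Finset.card_range, ← ENNReal.ofReal_natCast,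
    ← ENNReal.ofReal_mul (by positivity), ← ENNReal.ofReal_add (by positivity) (by positivity)]
  congr 1; push_cast; ring

theorem measurable_amf_loss {d : ℕ} {η : ℝ} (hη : 0 ≤ η) (p : TreePartition d) (t : ℕ) :
    Measurable fun q : (ℕ → Cube d × ℝ) × (Cube d × ℝ) =>
      ENNReal.ofReal ((amf η p q.1 t q.2.1 - q.2.2) ^ 2) := by
  have hm : Measurable fun q : (ℕ → Cube d × ℝ) × (Cube d × ℝ) => ((p, q.1), q.2.1) :=
    (measurable_const.prodMk measurable_fst).prodMk measurable_snd.fst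
  have h := (measurable_amf (d := d) hη t).comp hm
  simp only [Function.comp_def] at h
  exact ((h.sub measurable_snd.snd).pow_const 2).ennreal_ofReal

/-- Sample `t` is independent of the predictor built on samples `0, …, t - 1`, so testing on it has
the risk as its mean. -/
theorem lintegral_risk_amf_eq {η : ℝ} (hη : 0 ≤ η) (t : ℕ) :
    ∫⁻ z, risk P (amf η p z t) ∂(Measure.infinitePi fun _ : ℕ => P) =
      ∫⁻ z, ENNReal.ofReal ((amf η p z t (z t).1 - (z t).2) ^ 2)
        ∂(Measure.infinitePi fun _ : ℕ => P) := by
  exact (lintegral_fresh P t (f := fun z w => ENNReal.ofReal ((amf η p z t w.1 - w.2) ^ 2))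
    (measurable_amf_loss hη p t) fun z w x => by simp only [amf_update le_rfl]).symm

/-- The cumulative risk of AMF is at most that of a function which is constant on the cells of a
finite subtree, up to the cost of the aggregation and of the estimation of the constants. -/
theorem sum_lintegral_risk_amf_le_risk (hB : 0 < B) (hP : ∀ᵐ z ∂P, |z.2| ≤ B) (T : BinTree)
    {c : Node → ℝ} {g : Cube d → ℝ} (hg : Measurable g)
    (hc : ∀ u ∈ T.leavesFrom [], ∀ x ∈ p.cell u, g x = c u) {n : ℕ} (hn : 2 ≤ n) :
    ∑ t ∈ Finset.range n, ∫⁻ z, risk P (amf (1 / (8 * B ^ 2)) p z t)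
        ∂(Measure.infinitePi fun _ : ℕ => P) ≤
      n * risk P g + ENNReal.ofReal ((8 * (T.size * Real.log 2) +
        (T.leavesFrom []).card * harmonic (n - 1)) * B ^ 2) := by
  set η := 1 / (8 * B ^ 2) with hη
  have hη0 : 0 ≤ η := by positivity
  simp only [lintegral_risk_amf_eq hη0]
  rw [← lintegral_finsetSum]
  swap
  · intro t _
    have hm : Measurable fun z : ℕ → Cube d × ℝ => (z, z t) :=
      measurable_id.prodMk (measurable_pi_apply t)
    have h := (measurable_amf_loss hη0 p t).comp hm
    simp only [Function.comp_def] at h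
    exact h
  have hint : Integrable (fun z => treeLoss p z T n) (Measure.infinitePi fun _ : ℕ => P) := by
    simp only [treeLoss_eq_sum_leaves]
    exact integrable_finsetSum _ fun u _ => integrable_finsetSum _ fun t _ =>
      integrable_runningMean_loss hB.le hP ((measurableSet_cell p u).preimage measurable_fst) t
  have hH : (0 : ℝ) ≤ harmonic (n - 1) := by
    exact_mod_cast Finset.sum_nonneg (s := Finset.range (n - 1)) (f := fun i => ((i + 1 : ℕ) : ℚ)⁻¹)
      fun i _ => by positivity
  have hlog : 0 ≤ Real.log 2 := Real.log_nonneg (by norm_num)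
  calc ∫⁻ z, ∑ t ∈ Finset.range n, ENNReal.ofReal ((amf η p z t (z t).1 - (z t).2) ^ 2)
        ∂(Measure.infinitePi fun _ : ℕ => P)
      ≤ ∫⁻ z, ENNReal.ofReal (treeLoss p z T n + 8 * B ^ 2 * (T.size * Real.log 2))
          ∂(Measure.infinitePi fun _ : ℕ => P) := by
        refine lintegral_mono_ae ?_
        filter_upwards [ae_infinitePi_forall hP] with z hz
        rw [← ENNReal.ofReal_sum_of_nonneg fun _ _ => sq_nonneg _]
        exact ENNReal.ofReal_le_ofReal (sum_amf_loss_le hB (fun s _ => hz s) T)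
    _ = ENNReal.ofReal (∫ z, treeLoss p z T n ∂(Measure.infinitePi fun _ : ℕ => P) +
          8 * B ^ 2 * (T.size * Real.log 2)) := by
        rw [← ofReal_integral_eq_lintegral_ofReal (hint.fun_add (integrable_const _))
          (.of_forall fun z => add_nonneg (treeLoss_nonneg T n) (by positivity)),
          integral_add hint (integrable_const _)]
        simp
    _ ≤ ENNReal.ofReal (n * ∑ u ∈ T.leavesFrom [], ∫ x in Prod.fst ⁻¹' p.cell u, (c u - x.2) ^ 2 ∂P +
          (8 * (T.size * Real.log 2) + (T.leavesFrom []).card * harmonic (n - 1)) * B ^ 2) := by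
        refine ENNReal.ofReal_le_ofReal ?_
        linarith [integral_treeLoss_le (p := p) hB.le hP T c hn]
    _ ≤ _ := by
        rw [ENNReal.ofReal_add (by positivity) (by positivity), ENNReal.ofReal_mul (by positivity),
          ENNReal.ofReal_natCast]
        gcongr
        exact sum_leaves_le_risk hP T hg hc

theorem exists_leaf_values {T : BinTree} {l : ℝ} (hT : ∀ u ∈ T.leavesFrom [], p.IsLeafAt l u)
    {g : Cube d → ℝ} (hg : p.ConstOnCells l g) :
    ∃ c : Node → ℝ, ∀ u ∈ T.leavesFrom [], ∀ x ∈ p.cell u, g x = c u := by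
  classical
  refine ⟨fun u => if h : (p.cell u).Nonempty then g h.some else 0, fun u hu x hx => ?_⟩
  have h : (p.cell u).Nonempty := ⟨x, hx⟩
  simp only [dif_pos h]
  exact hg u (hT u hu) x hx _ h.some_mem

end FixedPartition

/-! ### The numerical comparison -/

/-- Both costs are compared in units of `B ^ 2`. The second alternative cannot be dropped: at `n =
2` the first one already fails for `N = 1`. -/
theorem regret_budget {n N : ℕ} (hn : 2 ≤ n) (hN : 1 ≤ N) :
    8 * ((2 * N - 1) * Real.log 2) + N * harmonic (n - 1) ≤ 8 * N * Real.log n ∨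
      (4 * n - 3 : ℝ) ≤ 8 * N * Real.log n := by
  have hl2 := Real.log_two_gt_d9
  have hl2' := Real.log_two_lt_d9
  have hN' : (1 : ℝ) ≤ N := by exact_mod_cast hN
  have hl3 : 1.5 * Real.log 2 ≤ Real.log 3 := by
    have : Real.log (2 ^ 3) ≤ Real.log (3 ^ 2) := Real.log_le_log (by norm_num) (by norm_num)
    rw [Real.log_pow, Real.log_pow] at this
    push_cast at this; linarith
  have hl4 : Real.log 4 = 2 * Real.log 2 := by
    rw [show (4 : ℝ) = 2 ^ 2 by norm_num, Real.log_pow]; norm_num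
  -- `6` is the least `n ≥ 2` for which `16 * log 2 + harmonic (n - 1) ≤ 8 * log n`, the requirement
  -- per leaf for large `N`.
  rcases le_or_gt 6 n with h6 | h6
  · left
    have hl6 : Real.log 2 + Real.log 3 ≤ Real.log n := by
      rw [← Real.log_mul (by norm_num) (by norm_num)]
      exact Real.log_le_log (by norm_num) (by norm_num; exact_mod_cast h6)
    have hH : (harmonic (n - 1) : ℝ) ≤ 1 + Real.log n := by
      refine (harmonic_le_one_add_log _).trans ?_
      gcongr
      · exact_mod_cast (by omega : 0 < n - 1)
      · omega
    have : N * (16 * Real.log 2 + (harmonic (n - 1) : ℝ)) ≤ N * (8 * Real.log n) := by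
      gcongr; linarith
    linarith
  · rcases hN.eq_or_lt with h1 | h1
    · subst h1
      interval_cases n
      · right; norm_num; linarith
      · left; norm_num [harmonic, Finset.sum_range_succ]; linarith
      · left; norm_num [harmonic, Finset.sum_range_succ]; linarith
      · left
        have : Real.log 4 ≤ Real.log 5 := Real.log_le_log (by norm_num) (by norm_num)
        norm_num [harmonic, Finset.sum_range_succ]; linarith
    · right
      have h2 : (2 : ℝ) ≤ N := by exact_mod_cast h1
      have hln : 0 ≤ Real.log n := Real.log_natCast_nonneg n
      refine le_trans ?_ (mul_le_mul_of_nonneg_right (by linarith : (16 : ℝ) ≤ 8 * N) hln)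
      interval_cases n
      · norm_num; linarith
      · norm_num; linarith
      · norm_num; linarith
      · have : Real.log 4 ≤ Real.log 5 := Real.log_le_log (by norm_num) (by norm_num)
        norm_num; linarith

/-- The cumulative regret of AMF against the functions that are constant on the cells of the time
pruning at `l`, when that pruning is a finite tree. -/
theorem sum_lintegral_risk_amf_le_of_finite {d : ℕ} {B : ℝ} {P : Measure (Cube d × ℝ)}
    [IsProbabilityMeasure P] {p : TreePartition d} (hB : 0 < B) (hP : ∀ᵐ z ∂P, |z.2| ≤ B) {l : ℝ}
    (hl : 0 ≤ l) (hfin : {v | p.birth v ≤ l}.Finite) {g : Cube d → ℝ} (hg : Measurable g)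
    (hgc : p.ConstOnCells l g) {n : ℕ} (hn : 2 ≤ n) :
    ∑ t ∈ Finset.range n, ∫⁻ z, risk P (amf (1 / (8 * B ^ 2)) p z t)
        ∂(Measure.infinitePi fun _ : ℕ => P) ≤
      n * risk P g + ENNReal.ofReal (8 * B ^ 2 * Real.log n) *
        ∑' v : Node, {p : TreePartition d | p.IsLeafAt l v}.indicator 1 p := by
  obtain ⟨T, hT⟩ := exists_pruning_of_finite hl hfin
  obtain ⟨c, hc⟩ := exists_leaf_values hT hgc
  set N := (T.leavesFrom []).card with hNd
  have hsize := T.size_add_one_eq []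
  have hN : 1 ≤ N := by omega
  have hlog : 0 ≤ Real.log n := Real.log_natCast_nonneg n
  -- The leaves of `T` are among the leaves of the pruning; this inclusion is enough because `N`
  -- enters the upper bound with a nonnegative factor.
  have hcount : (N : ℝ≥0∞) ≤ ∑' v : Node, {p : TreePartition d | p.IsLeafAt l v}.indicator 1 p := by
    refine le_trans (le_of_eq ?_) (ENNReal.sum_le_tsum (T.leavesFrom []))
    rw [Finset.sum_congr rfl fun u hu => Set.indicator_of_mem (s := {p : TreePartition d |
      p.IsLeafAt l u}) (hT u hu) 1]
    simp [hNd]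
  have hbound : ∑ t ∈ Finset.range n, ∫⁻ z, risk P (amf (1 / (8 * B ^ 2)) p z t)
        ∂(Measure.infinitePi fun _ : ℕ => P) ≤
      n * risk P g + ENNReal.ofReal (8 * N * Real.log n * B ^ 2) := by
    rcases regret_budget hn hN with h | h
    · refine (sum_lintegral_risk_amf_le_risk hB hP T hg hc hn).trans ?_
      gcongr
      refine le_trans (le_of_eq ?_) h
      have : (T.size : ℝ) = 2 * N - 1 := by
        rw [eq_sub_iff_add_eq]; exact_mod_cast hsize
      rw [this]
    · refine (sum_lintegral_risk_amf_le (by positivity) hB.le hP (by omega)).trans ?_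
      refine le_trans ?_ le_add_self
      gcongr
  refine hbound.trans ?_
  gcongr
  calc ENNReal.ofReal (8 * N * Real.log n * B ^ 2)
      = ENNReal.ofReal (8 * B ^ 2 * Real.log n) * N := by
        rw [← ENNReal.ofReal_natCast, ← ENNReal.ofReal_mul (by positivity)]
        congr 1; ring
    _ ≤ _ := by gcongr

/-! ### Sums over the nodes of the infinite binary tree -/

section NodeSum

/-- The descendants of `v` down to relative depth `k`, excluded. -/
def descendants : ℕ → Node → Finset Node
  | 0, _ => ∅
  | k + 1, v => insert v (descendants k (false :: v) ∪ descendants k (true :: v))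

theorem append_mem_descendants (w : Node) {v : Node} {k : ℕ} (h : w.length < k) :
    w ++ v ∈ descendants k v := by
  -- Words store their last letter first, so the first step below `v` is the last entry of `w`.
  induction w using List.reverseRecOn generalizing v k with
  | nil =>
    obtain ⟨k, rfl⟩ : ∃ m, k = m + 1 := ⟨k - 1, by omega⟩
    simp [descendants]
  | append_singleton w a ih =>
    obtain ⟨k, rfl⟩ : ∃ m, k = m + 1 := ⟨k - 1, by omega⟩
    have := ih (v := a :: v) (k := k) (by simp at h; omega)
    rw [List.append_assoc, List.singleton_append, descendants]
    refine Finset.mem_insert_of_mem (Finset.mem_union.2 ?_)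
    cases a
    exacts [.inl this, .inr this]

/-- Iterating the hypothesis `k` times and dropping the nonnegative values of `b` at the bottom
level gives the bound. Possible overlaps of the finite sets only decrease the sum, so disjointness
need not be proved. -/
theorem sum_descendants_le {c b : Node → ℝ≥0∞}
    (h : ∀ v, c v + (b (false :: v) + b (true :: v)) ≤ b v) (k : ℕ) (v : Node) :
    ∑ w ∈ descendants k v, c w ≤ b v := by
  induction k generalizing v with
  | zero => simp [descendants]
  | succ k ih =>
    refine le_trans ?_ (h v)
    have hU : ∑ w ∈ descendants k (false :: v) ∪ descendants k (true :: v), c w ≤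
        b (false :: v) + b (true :: v) := by
      refine le_trans ?_ (add_le_add (ih _) (ih _))
      rw [← Finset.sum_union_inter]
      exact le_self_add
    rw [descendants]
    by_cases hv : v ∈ descendants k (false :: v) ∪ descendants k (true :: v)
    · rw [Finset.insert_eq_of_mem hv]
      exact hU.trans le_add_self
    · rw [Finset.sum_insert hv]
      gcongr

/-- A nonnegative supersolution of the branching recursion dominates the total sum. -/
theorem tsum_node_le {c b : Node → ℝ≥0∞}
    (h : ∀ v, c v + (b (false :: v) + b (true :: v)) ≤ b v) : ∑' v, c v ≤ b [] := by
  rw [ENNReal.tsum_eq_iSup_sum]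
  refine iSup_le fun s => ?_
  have hs : s ⊆ descendants (s.sup List.length + 1) [] := fun w hw => by
    simpa using append_mem_descendants w (v := []) (Nat.lt_succ_of_le (Finset.le_sup (f := List.length) hw))
  exact (Finset.sum_le_sum_of_subset hs).trans (sum_descendants_le h _ _)

end NodeSum

/-! ### Boxes of the Mondrian process -/

section SampleBox

variable {d : ℕ}

theorem Box.side_child_false (b : Box d) (j : Fin d) (w : ℝ) (i : Fin d) :
    (b.child j (b.1 j + w * b.side j) false).side i = if i = j then w * b.side j else b.side i := by
  by_cases h : i = j
  · subst h; simp [Box.child, Box.side]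
  · simp [Box.child, Box.side, h]

theorem Box.side_child_true (b : Box d) (j : Fin d) (w : ℝ) (i : Fin d) :
    (b.child j (b.1 j + w * b.side j) true).side i =
      if i = j then (1 - w) * b.side j else b.side i := by
  by_cases h : i = j
  · subst h; simp [Box.child, Box.side]; ring
  · simp [Box.child, Box.side, h]

/-- The box has positive side lengths, which are at most one. -/
def Box.Nondegenerate (b : Box d) : Prop := ∀ j, 0 < b.side j ∧ b.side j ≤ 1

theorem Box.Nondegenerate.child {b : Box d} (hb : b.Nondegenerate) (j : Fin d) {w : ℝ}
    (hw : w ∈ Set.Ioo (0 : ℝ) 1) (a : Bool) :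
    (b.child j (b.1 j + w * b.side j) a).Nondegenerate := by
  intro i
  obtain ⟨h1, h2⟩ := hb j
  cases a
  · rw [Box.side_child_false]
    split_ifs
    · exact ⟨mul_pos hw.1 h1, by nlinarith [hw.2]⟩
    · exact hb i
  · rw [Box.side_child_true]
    split_ifs
    · exact ⟨mul_pos (by linarith [hw.2]) h1, by nlinarith [hw.1]⟩
    · exact hb i

theorem Box.Nondegenerate.dim_le {b : Box d} (hb : b.Nondegenerate) : b.dim ≤ d := by
  refine (Finset.sum_le_card_nsmul _ _ 1 fun j _ => (hb j).2).trans (by simp)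

variable [NeZero d]

theorem Box.Nondegenerate.dim_pos {b : Box d} (hb : b.Nondegenerate) : 0 < b.dim :=
  Finset.sum_pos (fun j _ => (hb j).1) Finset.univ_nonempty

theorem sampleBox_nondegenerate {r : Node → ℝ × ℝ × ℝ} (hr : ∀ v, (r v).2.2 ∈ Set.Ioo (0 : ℝ) 1)
    (v : Node) : (sampleBox r v : Box d).Nondegenerate := by
  induction v with
  | nil => intro j; simp [sampleBox, Box.side]
  | cons a v ih => exact ih.child _ (hr v) a

/-- The box of `v` uses the seeds of proper ancestors only, which are shorter words. With `w = v`,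
the seed at `v` is independent of the box it splits. -/
theorem sampleBox_update (r : Node → ℝ × ℝ × ℝ) (x : ℝ × ℝ × ℝ) {v w : Node}
    (h : v.length ≤ w.length) :
    (sampleBox (Function.update r w x) v : Box d) = sampleBox r v := by
  induction v with
  | nil => rfl
  | cons a v ih =>
    have hl : v.length < w.length := by simpa using h
    have hne : v ≠ w := fun e => by simp [e] at hl
    rw [sampleBox, sampleBox, ih hl.le, Function.update_of_ne hne]

theorem birth_update (r : Node → ℝ × ℝ × ℝ) (x : ℝ × ℝ × ℝ) {v w : Node}
    (h : v.length ≤ w.length) :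
    (sampleMondrian (Function.update r w x) : TreePartition d).birth v =
      (sampleMondrian r : TreePartition d).birth v := by
  induction v with
  | nil => rfl
  | cons a v ih =>
    have hl : v.length < w.length := by simpa using h
    have hne : v ≠ w := fun e => by simp [e] at hl
    rw [TreePartition.birth, TreePartition.birth, ih hl.le, TreePartition.wait, TreePartition.wait,
      sampleMondrian, sampleMondrian, sampleBox_update r x hl.le, Function.update_of_ne hne]

theorem birth_sampleMondrian_cons (r : Node → ℝ × ℝ × ℝ) (a : Bool) (v : Node) :
    (sampleMondrian r : TreePartition d).birth (a :: v) =
      (sampleMondrian r : TreePartition d).birth v + (r v).1 / (sampleBox r v : Box d).dim := rfl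

end SampleBox

/-! ### The law of one split -/

section OneSplit

variable {d : ℕ}

/-- The expected number of leaves of a Mondrian partition of the box `b` with lifetime `s`. -/
noncomputable def Box.leafMean (b : Box d) (s : ℝ) : ℝ := ∏ j, (1 + s * b.side j)

theorem Box.leafMean_nonneg {b : Box d} (hb : b.Nondegenerate) {s : ℝ} (hs : 0 ≤ s) :
    0 ≤ b.leafMean s :=
  Finset.prod_nonneg fun j _ => by have := (hb j).1; positivity

/-- The product is affine in each side length and the two parts of side `j` add up to that side. The
result does not involve `w`, so the law of the threshold plays no role in the expected leaf count.
-/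
theorem Box.leafMean_child_add (b : Box d) (j : Fin d) (w s : ℝ) :
    (b.child j (b.1 j + w * b.side j) false).leafMean s +
      (b.child j (b.1 j + w * b.side j) true).leafMean s =
      b.leafMean s + ∏ i ∈ Finset.univ.erase j, (1 + s * b.side i) := by
  unfold Box.leafMean
  simp only [Box.side_child_false, Box.side_child_true]
  rw [← Finset.mul_prod_erase _ _ (Finset.mem_univ j), ← Finset.mul_prod_erase _ _ (Finset.mem_univ j),
    ← Finset.mul_prod_erase _ _ (Finset.mem_univ j)]
  have h : ∀ c : ℝ, ∏ i ∈ Finset.univ.erase j, (1 + s * if i = j then c else b.side i) =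
      ∏ i ∈ Finset.univ.erase j, (1 + s * b.side i) := fun c =>
    Finset.prod_congr rfl fun i hi => by rw [if_neg (Finset.ne_of_mem_erase hi)]
  rw [h, h]
  simp only [if_true]
  ring

theorem Box.hasDerivAt_leafMean (b : Box d) (s : ℝ) :
    HasDerivAt b.leafMean (∑ j, (∏ i ∈ Finset.univ.erase j, (1 + s * b.side i)) * b.side j) s := by
  have h : b.leafMean = fun s => ∏ j, (1 + s * b.side j) := rfl
  have := HasDerivAt.fun_finsetProd (u := Finset.univ) (f := fun (j : Fin d) (s : ℝ) => 1 + s * b.side j)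
    (f' := fun j => b.side j) (x := s) fun j _ => by
      simpa using ((hasDerivAt_id s).mul_const (b.side j)).const_add 1
  simp only [smul_eq_mul] at this
  rw [h]
  exact this

variable [NeZero d]

instance : IsProbabilityMeasure (volume.restrict (Set.Icc (0 : ℝ) 1)) := ⟨by simp⟩

instance : IsProbabilityMeasure (expMeasure 1) := isProbabilityMeasure_expMeasure one_pos

theorem lintegral_expMeasure_one (f : ℝ → ℝ≥0∞) (hf : Measurable f) :
    ∫⁻ e, f e ∂(expMeasure 1) = ∫⁻ e in Set.Ioi 0, ENNReal.ofReal (Real.exp (-e)) * f e := by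
  have h : expMeasure 1 = volume.withDensity (exponentialPDF 1) := rfl
  have hm : Measurable (exponentialPDF 1) := (measurable_exponentialPDFReal 1).ennreal_ofReal
  rw [h, lintegral_withDensity_eq_lintegral_mul _ hm hf, ← setLIntegral_congr Ioi_ae_eq_Ici.symm,
    ← lintegral_indicator measurableSet_Ici]
  refine lintegral_congr fun e => ?_
  by_cases he : 0 ≤ e
  · simp [Set.indicator_of_mem (show e ∈ Set.Ici (0 : ℝ) from he), exponentialPDF_of_nonneg he]
  · simp [Set.indicator_of_notMem (show e ∉ Set.Ici (0 : ℝ) from he),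
      exponentialPDF_of_neg (not_le.1 he)]

theorem ae_expMeasure_pos : ∀ᵐ e ∂(expMeasure 1), 0 < e := by
  rw [ae_iff]
  have hm : MeasurableSet {e : ℝ | ¬ 0 < e} := (measurableSet_lt measurable_const measurable_id).compl
  rw [← lintegral_indicator_one hm, lintegral_expMeasure_one _ (measurable_one.indicator hm)]
  rw [setLIntegral_congr_fun (g := fun _ => 0) measurableSet_Ioi fun e he => ?_]
  · simp
  · have : e ∉ {e : ℝ | ¬ 0 < e} := fun h => h he
    rw [Set.indicator_of_notMem this, mul_zero]

theorem ae_nodeSeed : ∀ᵐ x ∂nodeSeed, 0 < x.1 ∧ x.2.2 ∈ Set.Ioo (0 : ℝ) 1 := by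
  have h1 : ∀ᵐ x ∂nodeSeed, 0 < x.1 :=
    Measure.quasiMeasurePreserving_fst.ae ae_expMeasure_pos
  have h0 : ∀ᵐ w ∂(volume.restrict (Set.Icc (0 : ℝ) 1)), w ∈ Set.Ioo (0 : ℝ) 1 := by
    rw [← restrict_Ioo_eq_restrict_Icc]
    exact ae_restrict_mem measurableSet_Ioo
  have h2 : ∀ᵐ x ∂nodeSeed, x.2.2 ∈ Set.Ioo (0 : ℝ) 1 :=
    (Measure.quasiMeasurePreserving_snd.comp Measure.quasiMeasurePreserving_snd).ae h0
  filter_upwards [h1, h2] with x hx1 hx2 using ⟨hx1, hx2⟩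

/-- The seeds selecting `j` lie between two consecutive normalized partial sums of side lengths. An
upper bound suffices, which avoids discussing endpoints. -/
theorem volume_pick_eq_le {b : Box d} (hb : b.Nondegenerate) (j : Fin d) :
    volume.restrict (Set.Icc (0 : ℝ) 1) {u | b.pick u = j} ≤ ENNReal.ofReal (b.side j / b.dim) := by
  have hA := hb.dim_pos
  set s0 := ∑ i ∈ Finset.Iio j, b.side i with hs0
  have hs1 : ∑ i ∈ Finset.Iic j, b.side i = s0 + b.side j := by
    rw [← Finset.Iio_insert, Finset.sum_insert (by simp), add_comm]
  have hsub : {u | b.pick u = j} ∩ Set.Icc (0 : ℝ) 1 ⊆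
      Set.Icc (s0 / b.dim) ((s0 + b.side j) / b.dim) := by
    rintro u ⟨hu, hu0, hu1⟩
    -- The last coordinate always qualifies since `u ≤ 1`, so the infimum is attained and is not a
    -- default value.
    have hne : {j : Fin d | u * b.dim ≤ ∑ i ∈ Finset.Iic j, b.side i}.Nonempty := by
      refine ⟨⊤, ?_⟩
      have : Finset.Iic (⊤ : Fin d) = Finset.univ := by ext; simp
      simp only [Set.mem_ofPred_eq, this]
      exact mul_le_of_le_one_left hA.le hu1
    have hmem := csInf_mem hne
    change b.pick u ∈ _ at hmem
    rw [show b.pick u = j from hu, Set.mem_ofPred_eq, hs1] at hmem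
    refine ⟨?_, (le_div_iff₀ hA).2 hmem⟩
    rw [div_le_iff₀ hA]
    rcases Nat.eq_zero_or_pos j.1 with h0 | h0
    · have : Finset.Iio j = ∅ := by
        ext i; simp [Fin.lt_def, h0]
      rw [hs0, this, Finset.sum_empty]
      positivity
    · have hlt : j.1 - 1 < d := by have := j.2; omega
      set i : Fin d := ⟨j.1 - 1, hlt⟩ with hi
      have hii : Finset.Iic i = Finset.Iio j := by
        ext k; simp only [Finset.mem_Iic, Finset.mem_Iio, Fin.le_def, Fin.lt_def, hi]; omega
      -- Minimality of `j` excludes its predecessor, which gives the lower endpoint.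
      have hnot : i ∉ {j : Fin d | u * b.dim ≤ ∑ i ∈ Finset.Iic j, b.side i} := by
        refine notMem_of_lt_csInf (?_ : i < b.pick u) (OrderBot.bddBelow _)
        rw [show b.pick u = j from hu, Fin.lt_def]
        simp only [hi]; omega
      rw [Set.mem_ofPred_eq, hii, not_le] at hnot
      exact hnot.le
  rw [Measure.restrict_apply' measurableSet_Icc]
  refine (measure_mono hsub).trans (le_of_eq ?_)
  rw [Real.volume_Icc]
  congr 1; ring

theorem lintegral_pick_le {b : Box d} (hb : b.Nondegenerate) (f : Fin d → ℝ≥0∞) :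
    ∫⁻ u, f (b.pick u) ∂(volume.restrict (Set.Icc (0 : ℝ) 1)) ≤
      ∑ j, f j * ENNReal.ofReal (b.side j / b.dim) := by
  have hm := (measurable_pick (d := d)).comp
    (measurable_const.prodMk measurable_id : Measurable fun u : ℝ => (b, u))
  simp only [Function.comp_def] at hm
  rw [← lintegral_map (measurable_of_finite f) hm, lintegral_fintype]
  refine Finset.sum_le_sum fun j _ => ?_
  refine mul_le_mul_right ?_ _
  rw [Measure.map_apply hm (measurableSet_singleton j)]
  exact volume_pick_eq_le hb j

/-- Integration over the waiting time: the recursion satisfied by the expected number of leaves. -/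
theorem lintegral_wait_leafMean {b : Box d} (hb : b.Nondegenerate) {s : ℝ} (hs : 0 ≤ s) :
    ∫⁻ e, (if e ≤ b.dim * s then ENNReal.ofReal (b.leafMean (s - e / b.dim) +
      (∑ j, (∏ i ∈ Finset.univ.erase j, (1 + (s - e / b.dim) * b.side i)) * b.side j) / b.dim)
        else 1) ∂(expMeasure 1) = ENNReal.ofReal (b.leafMean s) := by
  have hA := hb.dim_pos
  set A := b.dim with hAd
  set G' : ℝ → ℝ := fun s => ∑ j, (∏ i ∈ Finset.univ.erase j, (1 + s * b.side i)) * b.side j with hG'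
  have hGm : Continuous b.leafMean := by unfold Box.leafMean; fun_prop
  have hGm' : Continuous G' := by simp only [hG']; fun_prop
  have hm : Measurable fun e : ℝ => ENNReal.ofReal (b.leafMean (s - e / A) + G' (s - e / A) / A) :=
    (by fun_prop : Continuous fun e : ℝ => b.leafMean (s - e / A) + G' (s - e / A) / A).measurable.ennreal_ofReal
  have hmi : Measurable fun e : ℝ => if e ≤ A * s then
      ENNReal.ofReal (b.leafMean (s - e / A) + G' (s - e / A) / A) else 1 :=
    Measurable.ite (measurableSet_le measurable_id measurable_const) hm measurable_const
  change ∫⁻ e, (if e ≤ A * s then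
    ENNReal.ofReal (b.leafMean (s - e / A) + G' (s - e / A) / A) else 1) ∂(expMeasure 1) = _
  rw [lintegral_expMeasure_one _ hmi, ← Set.Ioc_union_Ioi_eq_Ioi (mul_nonneg hA.le hs : 0 ≤ A * s),
    lintegral_union measurableSet_Ioi (Set.Ioc_disjoint_Ioi le_rfl)]
  have h2 : ∫⁻ e in Set.Ioi (A * s), ENNReal.ofReal (Real.exp (-e)) *
      (if e ≤ A * s then ENNReal.ofReal (b.leafMean (s - e / A) + G' (s - e / A) / A) else 1) =
      ENNReal.ofReal (Real.exp (-(A * s))) := by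
    rw [setLIntegral_congr_fun (g := fun e => ENNReal.ofReal (Real.exp (-e))) measurableSet_Ioi
      fun e he => by simp [not_le.2 (show A * s < e from he)]]
    rw [← ofReal_integral_eq_lintegral_ofReal (integrableOn_exp_neg_Ioi _)
      (.of_forall fun _ => (Real.exp_pos _).le), integral_exp_neg_Ioi]
  have hcont : Continuous fun e : ℝ => Real.exp (-e) * (b.leafMean (s - e / A) + G' (s - e / A) / A) := by
    fun_prop
  have h1 : ∫⁻ e in Set.Ioc 0 (A * s), ENNReal.ofReal (Real.exp (-e)) *
      (if e ≤ A * s then ENNReal.ofReal (b.leafMean (s - e / A) + G' (s - e / A) / A) else 1) =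
      ENNReal.ofReal (b.leafMean s - Real.exp (-(A * s))) := by
    rw [setLIntegral_congr_fun (g := fun e => ENNReal.ofReal (Real.exp (-e) *
      (b.leafMean (s - e / A) + G' (s - e / A) / A))) measurableSet_Ioc
      fun e he => by simp only [if_pos he.2]; rw [ENNReal.ofReal_mul (Real.exp_pos _).le]]
    rw [← ofReal_integral_eq_lintegral_ofReal
      (hcont.integrableOn_Ioc) ?_]
    · rw [← intervalIntegral.integral_of_le (mul_nonneg hA.le hs)]
      -- The integrand is an exact derivative. The boundary terms are `b.leafMean s` and `exp (-(A *
      -- s))`, since `b.leafMean 0 = 1`; the latter is restored by the event of no split.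
      have hder : ∀ e ∈ Set.uIcc 0 (A * s), HasDerivAt (fun e => -(Real.exp (-e) * b.leafMean (s - e / A)))
          (Real.exp (-e) * (b.leafMean (s - e / A) + G' (s - e / A) / A)) e := by
        intro e _
        have d1 : HasDerivAt (fun e : ℝ => Real.exp (-e)) (-Real.exp (-e)) e := by
          simpa using (hasDerivAt_neg e).exp
        have d2 : HasDerivAt (fun e : ℝ => s - e / A) (-(1 / A)) e := by
          simpa using ((hasDerivAt_id e).div_const A).const_sub s
        have d3 := (b.hasDerivAt_leafMean (s - e / A)).comp e d2
        convert! (d1.mul d3).neg using 1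
        simp only [hG', Function.comp]
        ring
      rw [intervalIntegral.integral_eq_sub_of_hasDerivAt hder (hcont.intervalIntegrable _ _)]
      congr 1
      have : A * s / A = s := by field_simp
      rw [this]
      simp [Box.leafMean]
      ring
    · refine (ae_restrict_iff' measurableSet_Ioc).2 (.of_forall fun e he => ?_)
      have h0 : 0 ≤ s - e / A := by
        rw [sub_nonneg, div_le_iff₀ hA]; linarith [he.2]
      refine mul_nonneg (Real.exp_pos _).le (add_nonneg (b.leafMean_nonneg hb h0) (div_nonneg ?_ hA.le))
      refine Finset.sum_nonneg fun j _ => mul_nonneg (Finset.prod_nonneg fun i _ => ?_) (hb j).1.le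
      have := (hb i).1; positivity
  have hexp : Real.exp (-(A * s)) ≤ b.leafMean s := by
    refine (Real.exp_le_one_iff.2 (by nlinarith [mul_nonneg hA.le hs])).trans ?_
    rw [← Finset.prod_const_one (s := (Finset.univ : Finset (Fin d)))]
    refine Finset.prod_le_prod (fun _ _ => zero_le_one) fun j _ => ?_
    have := mul_nonneg hs (hb j).1.le
    linarith
  rw [h1, h2, ← ENNReal.ofReal_add (sub_nonneg.2 hexp) (Real.exp_pos _).le, sub_add_cancel]

end OneSplit

/-! ### The expected number of leaves of the time pruning -/

section LeafCount

variable {d : ℕ}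

/-- The expected number of leaves, at time `l`, below a node with birth time `τ` and box `b`. -/
noncomputable def leafBound (l τ : ℝ) (b : Box d) : ℝ≥0∞ :=
  if τ ≤ l then ENNReal.ofReal (b.leafMean (l - τ)) else 0

theorem measurable_leafBound (l : ℝ) : Measurable fun q : ℝ × Box d => leafBound l q.1 q.2 := by
  refine Measurable.ite (measurableSet_le measurable_fst measurable_const) ?_ measurable_const
  have : Measurable fun q : ℝ × Box d => ∏ j, (1 + (l - q.1) * (q.2.2 j - q.2.1 j)) := by fun_prop
  exact this.ennreal_ofReal

variable [NeZero d]

/-- The threshold seed integrates out with mass one. Stating only an inequality lets `H` be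
arbitrary, with no measurability required. -/
theorem lintegral_nodeSeed_le {b : Box d} (hb : b.Nondegenerate) (H : ℝ → Fin d → ℝ≥0∞) :
    ∫⁻ x, H x.1 (b.pick x.2.1) ∂nodeSeed ≤
      ∫⁻ e, ∑ j, H e j * ENNReal.ofReal (b.side j / b.dim) ∂(expMeasure 1) := by
  unfold nodeSeed
  refine (lintegral_prod_le _).trans (lintegral_mono fun e => ?_)
  refine (lintegral_prod_le _).trans (le_trans (le_of_eq ?_) (lintegral_pick_le hb (H e)))
  refine lintegral_congr fun u => ?_
  simp only [lintegral_const, measure_univ, mul_one]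

/-- One step of the recursion for the expected number of leaves. -/
theorem lintegral_leafBound_step_le {b : Box d} (hb : b.Nondegenerate) (l τ : ℝ) :
    ∫⁻ x, ((if τ ≤ l ∧ l < τ + x.1 / b.dim then 1 else 0) +
      (leafBound l (τ + x.1 / b.dim) (b.child (sampleSplit b x).2.1 (sampleSplit b x).2.2 false) +
       leafBound l (τ + x.1 / b.dim) (b.child (sampleSplit b x).2.1 (sampleSplit b x).2.2 true)))
      ∂nodeSeed ≤ leafBound l τ b := by
  have hA := hb.dim_pos
  rcases le_or_gt τ l with hτ | hτ
  · set s := l - τ with hsd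
    have hs : 0 ≤ s := sub_nonneg.2 hτ
    -- Value `1` if the box is still whole at time `l`, and otherwise the sum over its two children,
    -- already free of the threshold.
    set H : ℝ → Fin d → ℝ≥0∞ := fun e j => if e ≤ b.dim * s then
      ENNReal.ofReal (b.leafMean (s - e / b.dim) +
        ∏ i ∈ Finset.univ.erase j, (1 + (s - e / b.dim) * b.side i)) else 1 with hH
    have hcmp : ∀ e : ℝ, e ≤ b.dim * s ↔ τ + e / b.dim ≤ l := fun e => by
      rw [← le_sub_iff_add_le', div_le_iff₀ hA, mul_comm]
    calc _ ≤ ∫⁻ x, H x.1 (b.pick x.2.1) ∂nodeSeed := by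
          refine lintegral_mono_ae ?_
          filter_upwards [ae_nodeSeed] with x hx
          by_cases he : x.1 ≤ b.dim * s
          · have he' := (hcmp _).1 he
            have hns : ∀ a, (b.child (sampleSplit b x).2.1 (sampleSplit b x).2.2 a).Nondegenerate :=
              fun a => hb.child _ hx.2 a
            simp only [hH, if_pos he, leafBound, if_pos he', not_lt.2 he', and_false, if_false, zero_add]
            have e1 : l - (τ + x.1 / b.dim) = s - x.1 / b.dim := by rw [hsd]; ring
            have h0 : 0 ≤ s - x.1 / b.dim := by rw [← e1]; linarith
            rw [e1, ← ENNReal.ofReal_add (Box.leafMean_nonneg (hns _) h0) (Box.leafMean_nonneg (hns _) h0)]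
            exact (congrArg _ (b.leafMean_child_add _ _ _)).le
          · have he' := mt (hcmp _).2 he
            simp only [hH, if_neg he, leafBound, if_neg he', add_zero]
            split_ifs <;> simp
      _ ≤ ∫⁻ e, ∑ j, H e j * ENNReal.ofReal (b.side j / b.dim) ∂(expMeasure 1) :=
          lintegral_nodeSeed_le hb H
      _ = ∫⁻ e, (if e ≤ b.dim * s then ENNReal.ofReal (b.leafMean (s - e / b.dim) +
            (∑ j, (∏ i ∈ Finset.univ.erase j, (1 + (s - e / b.dim) * b.side i)) * b.side j) / b.dim)
            else 1) ∂(expMeasure 1) := by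
          -- Averaging over the coordinate with weights `|C^j| / |C|` turns the products with one
          -- factor removed into the derivative of `b.leafMean` divided by `|C|`.
          refine lintegral_congr fun e => ?_
          have hsum : ∑ j, b.side j / b.dim = 1 := by
            rw [← Finset.sum_div]; exact div_self hA.ne'
          have hn : ∀ j, 0 ≤ b.side j / b.dim := fun j => div_nonneg (hb j).1.le hA.le
          by_cases he : e ≤ b.dim * s
          · have h0 : 0 ≤ s - e / b.dim := by
              rw [sub_nonneg, div_le_iff₀ hA]; linarith
            have hpos : ∀ j, 0 ≤ b.leafMean (s - e / b.dim) +
                ∏ i ∈ Finset.univ.erase j, (1 + (s - e / b.dim) * b.side i) := fun j =>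
              add_nonneg (b.leafMean_nonneg hb h0) (Finset.prod_nonneg fun i _ => by
                have := mul_nonneg h0 (hb i).1.le; linarith)
            simp only [hH, if_pos he]
            simp only [← ENNReal.ofReal_mul (hpos _)]
            rw [← ENNReal.ofReal_sum_of_nonneg fun j _ => mul_nonneg (hpos j) (hn j)]
            congr 1
            simp only [add_mul, Finset.sum_add_distrib, ← Finset.mul_sum, hsum, mul_one,
              Finset.sum_div, mul_div_assoc]
          · simp only [hH, if_neg he, one_mul]
            rw [← ENNReal.ofReal_sum_of_nonneg fun j _ => hn j, hsum, ENNReal.ofReal_one]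
      _ = leafBound l τ b := by
          rw [lintegral_wait_leafMean hb hs, leafBound, if_pos hτ]
  · refine le_of_eq_of_le (lintegral_congr_ae (g := fun _ => 0) ?_) (by simp)
    filter_upwards [ae_nodeSeed] with x hx
    have h1 : ¬ τ ≤ l := not_le.2 hτ
    have h2 : ¬ τ + x.1 / b.dim ≤ l := by
      have := div_pos hx.1 hA
      linarith
    simp [leafBound, h1, h2]

theorem ae_seed_nondegenerate :
    ∀ᵐ r ∂(Measure.infinitePi fun _ : Node => nodeSeed),
      ∀ v, (sampleBox r v : Box d).Nondegenerate := by
  have : ∀ᵐ r ∂(Measure.infinitePi fun _ : Node => nodeSeed), ∀ v : Node,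
      (r v).2.2 ∈ Set.Ioo (0 : ℝ) 1 := ae_all_iff.2 fun v =>
    (measurePreserving_eval_infinitePi (fun _ : Node => nodeSeed) v).quasiMeasurePreserving.ae
      (ae_nodeSeed.mono fun _ h => h.2)
  filter_upwards [this] with r hr using sampleBox_nondegenerate hr

theorem measurable_birth_sampleMondrian (v : Node) :
    Measurable fun r : Node → ℝ × ℝ × ℝ => (sampleMondrian r : TreePartition d).birth v :=
  (measurable_birth v).comp measurable_sampleMondrian

/-- The seed at `v` is fresh given the birth time and box of `v`, so the one-step inequality
integrates. The expected leaf bounds thus form a supersolution of the branching recursion whose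
source is the probability that `v` is a leaf. -/
theorem lintegral_leafBound_node_le (l : ℝ) (v : Node) :
    ∫⁻ r, {p : TreePartition d | p.IsLeafAt l v}.indicator (1 : TreePartition d → ℝ≥0∞) (sampleMondrian r : TreePartition d)
        ∂(Measure.infinitePi fun _ : Node => nodeSeed) +
      (∫⁻ r, leafBound l ((sampleMondrian r : TreePartition d).birth (false :: v))
          (sampleBox r (false :: v) : Box d) ∂(Measure.infinitePi fun _ : Node => nodeSeed) +
        ∫⁻ r, leafBound l ((sampleMondrian r : TreePartition d).birth (true :: v))
          (sampleBox r (true :: v) : Box d) ∂(Measure.infinitePi fun _ : Node => nodeSeed)) ≤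
      ∫⁻ r, leafBound l ((sampleMondrian r : TreePartition d).birth v) (sampleBox r v : Box d)
          ∂(Measure.infinitePi fun _ : Node => nodeSeed) := by
  have hmb : ∀ w, Measurable fun r : Node → ℝ × ℝ × ℝ => leafBound l
      ((sampleMondrian r : TreePartition d).birth w) (sampleBox r w : Box d) := fun w => by
    have h := (measurable_leafBound (d := d) l).comp
      ((measurable_birth_sampleMondrian (d := d) w).prodMk (measurable_sampleBox (d := d) w))
    simp only [Function.comp_def] at h
    exact h
  set F : (Node → ℝ × ℝ × ℝ) → ℝ × ℝ × ℝ → ℝ≥0∞ := fun r x =>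
    (if (sampleMondrian r : TreePartition d).birth v ≤ l ∧
      l < (sampleMondrian r : TreePartition d).birth v + x.1 / (sampleBox r v : Box d).dim then 1 else 0) +
    (leafBound l ((sampleMondrian r : TreePartition d).birth v + x.1 / (sampleBox r v : Box d).dim)
      ((sampleBox r v : Box d).child (sampleSplit (sampleBox r v : Box d) x).2.1
        (sampleSplit (sampleBox r v : Box d) x).2.2 false) +
     leafBound l ((sampleMondrian r : TreePartition d).birth v + x.1 / (sampleBox r v : Box d).dim)
      ((sampleBox r v : Box d).child (sampleSplit (sampleBox r v : Box d) x).2.1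
        (sampleSplit (sampleBox r v : Box d) x).2.2 true)) with hF
  have hFm : Measurable (Function.uncurry F) := by
    have m1 : Measurable fun q : (Node → ℝ × ℝ × ℝ) × (ℝ × ℝ × ℝ) => (sampleBox q.1 v : Box d) :=
      (measurable_sampleBox v).comp measurable_fst
    have m2 : Measurable fun q : (Node → ℝ × ℝ × ℝ) × (ℝ × ℝ × ℝ) =>
        (sampleMondrian q.1 : TreePartition d).birth v :=
      (measurable_birth_sampleMondrian v).comp measurable_fst
    have m3 : Measurable fun q : (Node → ℝ × ℝ × ℝ) × (ℝ × ℝ × ℝ) =>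
        sampleSplit (sampleBox q.1 v : Box d) q.2 :=
      measurable_sampleSplit.comp (m1.prodMk measurable_snd)
    have m4 : Measurable fun q : (Node → ℝ × ℝ × ℝ) × (ℝ × ℝ × ℝ) =>
        (sampleMondrian q.1 : TreePartition d).birth v + q.2.1 / (sampleBox q.1 v : Box d).dim :=
      m2.add (measurable_snd.fst.div (measurable_dim.comp m1))
    have m5 : ∀ a, Measurable fun q : (Node → ℝ × ℝ × ℝ) × (ℝ × ℝ × ℝ) =>
        (sampleBox q.1 v : Box d).child (sampleSplit (sampleBox q.1 v : Box d) q.2).2.1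
        (sampleSplit (sampleBox q.1 v : Box d) q.2).2.2 a := fun a => by
      have h := (measurable_child (d := d) a).comp (m1.prodMk m3.snd)
      simp only [Function.comp_def] at h
      exact h
    have m6 : ∀ a, Measurable fun q : (Node → ℝ × ℝ × ℝ) × (ℝ × ℝ × ℝ) => leafBound l
        ((sampleMondrian q.1 : TreePartition d).birth v + q.2.1 / (sampleBox q.1 v : Box d).dim)
        ((sampleBox q.1 v : Box d).child (sampleSplit (sampleBox q.1 v : Box d) q.2).2.1
        (sampleSplit (sampleBox q.1 v : Box d) q.2).2.2 a) := fun a => by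
      have h := (measurable_leafBound (d := d) l).comp (m4.prodMk (m5 a))
      simp only [Function.comp_def] at h
      exact h
    refine Measurable.add (Measurable.ite ?_ measurable_const measurable_const) ((m6 false).add (m6 true))
    exact (measurableSet_le m2 measurable_const).inter (measurableSet_lt measurable_const m4)
  have hlm : Measurable fun r : Node → ℝ × ℝ × ℝ =>
      {p : TreePartition d | p.IsLeafAt l v}.indicator (1 : TreePartition d → ℝ≥0∞) (sampleMondrian r) :=
    (measurable_one.indicator (measurableSet_isLeafAt l v)).comp measurable_sampleMondrian
  have hFu : ∀ r w x, F (Function.update r v w) x = F r x := fun r w x => by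
    simp only [hF, sampleBox_update r w le_rfl, birth_update r w le_rfl]
  rw [← lintegral_add_left (hmb _), ← lintegral_add_left hlm]
  refine le_trans (le_of_eq ?_) ((lintegral_fresh nodeSeed v hFm hFu).trans_le ?_)
  · refine lintegral_congr fun r => ?_
    simp only [hF]
    refine congrArg₂ _ ?_ rfl
    by_cases h : (sampleMondrian r : TreePartition d).IsLeafAt l v
    · rw [Set.indicator_of_mem (show _ ∈ {p : TreePartition d | p.IsLeafAt l v} from h)]
      exact (if_pos h).symm
    · rw [Set.indicator_of_notMem (show _ ∉ {p : TreePartition d | p.IsLeafAt l v} from h)]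
      exact (if_neg h).symm
  · refine lintegral_mono_ae ?_
    filter_upwards [ae_seed_nondegenerate (d := d)] with r hr
    exact lintegral_leafBound_step_le (hr v) l _

/-- The expected number of leaves of the Mondrian partition with lifetime `l` of the unit cube. -/
theorem lintegral_leaf_count_le {l : ℝ} (hl : 0 ≤ l) :
    ∫⁻ p, ∑' v : Node, {p : TreePartition d | p.IsLeafAt l v}.indicator 1 p ∂(mondrianMeasure d) ≤
      ENNReal.ofReal ((1 + l) ^ d) := by
  have hm : ∀ v, Measurable
      ({p : TreePartition d | p.IsLeafAt l v}.indicator (1 : TreePartition d → ℝ≥0∞)) := fun v =>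
    measurable_one.indicator (measurableSet_isLeafAt l v)
  rw [lintegral_tsum fun v => (hm v).aemeasurable]
  simp only [mondrianMeasure, lintegral_map (hm _) measurable_sampleMondrian]
  refine (tsum_node_le (lintegral_leafBound_node_le (d := d) l)).trans (le_of_eq ?_)
  simp [sampleBox, TreePartition.birth, leafBound, hl, Box.leafMean, Box.side]

/-! ### The time pruning is a finite tree -/

/-- As `|C| ≤ d`, the wait is at least `e / d` with `e` of law `Exp(1)`, and the mean of `exp (-(3 *
e))` is `1 / 4`. The rate `3 * d` is chosen so that this factor beats the two children per node. -/
theorem lintegral_exp_birth_cons_le (a : Bool) (v : Node) :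
    ∫⁻ r, ENNReal.ofReal (Real.exp (-(3 * d * (sampleMondrian r : TreePartition d).birth (a :: v))))
        ∂(Measure.infinitePi fun _ : Node => nodeSeed) ≤
      4⁻¹ * ∫⁻ r, ENNReal.ofReal (Real.exp (-(3 * d * (sampleMondrian r : TreePartition d).birth v)))
        ∂(Measure.infinitePi fun _ : Node => nodeSeed) := by
  have hm : Measurable fun r : Node → ℝ × ℝ × ℝ =>
      ENNReal.ofReal (Real.exp (-(3 * d * (sampleMondrian r : TreePartition d).birth v))) :=
    ((measurable_birth_sampleMondrian v).const_mul _).neg.exp.ennreal_ofReal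
  set F : (Node → ℝ × ℝ × ℝ) → ℝ × ℝ × ℝ → ℝ≥0∞ := fun r x =>
    ENNReal.ofReal (Real.exp (-(3 * d * (sampleMondrian r : TreePartition d).birth v))) *
      ENNReal.ofReal (Real.exp (-(3 * x.1))) with hF
  have hFm : Measurable (Function.uncurry F) :=
    (hm.comp measurable_fst).mul ((measurable_snd.fst.const_mul 3).neg.exp.ennreal_ofReal)
  have hFu : ∀ r w x, F (Function.update r v w) x = F r x := fun r w x => by
    simp only [hF, birth_update r w le_rfl]
  have hpos : ∀ᵐ r ∂(Measure.infinitePi fun _ : Node => nodeSeed), 0 < (r v).1 :=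
    (measurePreserving_eval_infinitePi (fun _ : Node => nodeSeed) v).quasiMeasurePreserving.ae
      (ae_nodeSeed.mono fun _ h => h.1)
  have hseed : ∫⁻ x, ENNReal.ofReal (Real.exp (-(3 * x.1))) ∂nodeSeed ≤ 4⁻¹ := by
    unfold nodeSeed
    refine (lintegral_prod_le _).trans ?_
    simp only [lintegral_const, measure_univ, mul_one]
    rw [lintegral_expMeasure_one _ (by fun_prop)]
    have : ∀ e : ℝ, ENNReal.ofReal (Real.exp (-e)) * ENNReal.ofReal (Real.exp (-(3 * e))) =
        ENNReal.ofReal (Real.exp (-4 * e)) := fun e => by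
      rw [← ENNReal.ofReal_mul (Real.exp_pos _).le, ← Real.exp_add]
      congr 2; ring
    simp only [this]
    rw [← ofReal_integral_eq_lintegral_ofReal (integrableOn_exp_mul_Ioi (by norm_num) 0)
      (.of_forall fun _ => (Real.exp_pos _).le), integral_exp_mul_Ioi (by norm_num)]
    rw [← ENNReal.ofReal_ofNat, ← ENNReal.ofReal_inv_of_pos (by norm_num)]
    exact ENNReal.ofReal_le_ofReal (by norm_num)
  calc _ ≤ ∫⁻ r, F r (r v) ∂(Measure.infinitePi fun _ : Node => nodeSeed) := by
        refine lintegral_mono_ae ?_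
        filter_upwards [ae_seed_nondegenerate (d := d), hpos] with r hr hr0
        have hA := (hr v).dim_pos
        simp only [hF]
        rw [← ENNReal.ofReal_mul (Real.exp_pos _).le, ← Real.exp_add, birth_sampleMondrian_cons]
        refine ENNReal.ofReal_le_ofReal (Real.exp_le_exp.2 ?_)
        have h1 : (r v).1 ≤ d * ((r v).1 / (sampleBox r v : Box d).dim) := by
          rw [mul_div_assoc', le_div_iff₀ hA, mul_comm]
          exact mul_le_mul_of_nonneg_right (hr v).dim_le hr0.le
        linarith
    _ = ∫⁻ r, ∫⁻ x, F r x ∂nodeSeed ∂(Measure.infinitePi fun _ : Node => nodeSeed) :=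
        lintegral_fresh nodeSeed v hFm hFu
    _ ≤ ∫⁻ r, 4⁻¹ * ENNReal.ofReal
          (Real.exp (-(3 * d * (sampleMondrian r : TreePartition d).birth v)))
          ∂(Measure.infinitePi fun _ : Node => nodeSeed) := by
        refine lintegral_mono fun r => ?_
        simp only [hF]
        rw [lintegral_const_mul _ (by fun_prop), mul_comm]
        gcongr
    _ = _ := lintegral_const_mul _ hm

/-- Markov's inequality bounds the probability that `v` is born by time `l` by a multiple of `E v`;
these are summable over the tree, and Borel–Cantelli concludes. -/
theorem ae_finite_pruning (l : ℝ) :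
    ∀ᵐ p ∂(mondrianMeasure d), {v | p.birth v ≤ l}.Finite := by
  set E : Node → ℝ≥0∞ := fun v =>
    ∫⁻ r, ENNReal.ofReal (Real.exp (-(3 * d * (sampleMondrian r : TreePartition d).birth v)))
        ∂(Measure.infinitePi fun _ : Node => nodeSeed) with hE
  have hmE : ∀ v, Measurable fun p : TreePartition d =>
      ENNReal.ofReal (Real.exp (-(3 * d * p.birth v))) := fun v =>
    ((measurable_birth v).const_mul _).neg.exp.ennreal_ofReal
  have hEs : ∑' v, E v ≤ 2 := by
    -- The supersolution `2 * E` reflects `∑ 2 ^ k * 4⁻¹ ^ k = 2` over the levels below a node.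
    have hstep : ∀ v, E v + (2 * E (false :: v) + 2 * E (true :: v)) ≤ 2 * E v := fun v => by
      have h0 : ∀ a, E (a :: v) ≤ 4⁻¹ * E v := fun a => lintegral_exp_birth_cons_le a v
      calc E v + (2 * E (false :: v) + 2 * E (true :: v))
          ≤ E v + (2 * (4⁻¹ * E v) + 2 * (4⁻¹ * E v)) := by gcongr <;> exact h0 _
        _ = E v + (4 * 4⁻¹) * E v := by ring
        _ = 2 * E v := by
          rw [ENNReal.mul_inv_cancel (by norm_num) (by norm_num)]; ring
    refine (tsum_node_le (b := fun v => 2 * E v) hstep).trans (le_of_eq ?_)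
    simp [hE, TreePartition.birth]
  refine ae_finite_setOfPred_mem (s := fun v => {p : TreePartition d | p.birth v ≤ l}) ?_
  have hle : ∀ v, mondrianMeasure d {p : TreePartition d | p.birth v ≤ l} ≤
      ENNReal.ofReal (Real.exp (3 * d * l)) * E v := fun v => by
    have hS : MeasurableSet {p : TreePartition d | p.birth v ≤ l} :=
      measurableSet_le (measurable_birth v) measurable_const
    have e : E v = ∫⁻ p, ENNReal.ofReal (Real.exp (-(3 * d * p.birth v))) ∂(mondrianMeasure d) := by
      rw [mondrianMeasure, lintegral_map (hmE v) measurable_sampleMondrian]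
    rw [e, ← lintegral_const_mul _ (hmE v), ← lintegral_indicator_one hS]
    refine lintegral_mono fun p => ?_
    by_cases hp : p ∈ {p : TreePartition d | p.birth v ≤ l}
    · rw [Set.indicator_of_mem hp, Pi.one_apply, ← ENNReal.ofReal_mul (Real.exp_pos _).le,
        ← Real.exp_add, ← ENNReal.ofReal_one]
      refine ENNReal.ofReal_le_ofReal (Real.one_le_exp ?_)
      have : 3 * (d : ℝ) * p.birth v ≤ 3 * d * l := by gcongr; exact hp
      linarith
    · rw [Set.indicator_of_notMem hp]; exact zero_le
  refine ne_top_of_le_ne_top ?_ (ENNReal.tsum_le_tsum hle)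
  rw [ENNReal.tsum_mul_left]
  exact ENNReal.mul_ne_top ENNReal.ofReal_ne_top (ne_top_of_le_ne_top (by norm_num) hEs)

end LeafCount

/-! ### The oracle inequality -/

section Oracle

variable {d : ℕ}

/-- Joint measurability of the risk of AMF in the partition and the samples. -/
theorem measurable_risk_amf {η : ℝ} (hη : 0 ≤ η) (P : Measure (Cube d × ℝ)) [IsProbabilityMeasure P]
    (t : ℕ) : Measurable fun q : TreePartition d × (ℕ → Cube d × ℝ) => risk P (amf η q.1 q.2 t) := by
  have hm : Measurable fun q : (TreePartition d × (ℕ → Cube d × ℝ)) × (Cube d × ℝ) =>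
      (q.1, q.2.1) := measurable_fst.prodMk measurable_snd.fst
  have h := (measurable_amf (d := d) hη t).comp hm
  simp only [Function.comp_def] at h
  have h2 : Measurable fun q : (TreePartition d × (ℕ → Cube d × ℝ)) × (Cube d × ℝ) =>
      ENNReal.ofReal ((amf η q.1.1 q.1.2 t q.2.1 - q.2.2) ^ 2) :=
    ((h.sub measurable_snd.snd).pow_const 2).ennreal_ofReal
  exact h2.lintegral_prod_right'

variable [NeZero d]

/-- The expected risk of the online-to-batch conversion is the average of the expected risks. -/
theorem lintegral_risk_online_to_batch {η : ℝ} (hη : 0 ≤ η) (P : Measure (Cube d × ℝ))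
    [IsProbabilityMeasure P] {n : ℕ} (hn : n ≠ 0) {Ω : Type*} [MeasurableSpace Ω] (μ : Measure Ω)
    [IsProbabilityMeasure μ] (M : Ω → TreePartition d) (hM : HasLaw M (mondrianMeasure d) μ)
    (Z : ℕ → Ω → Cube d × ℝ) (hZ : ∀ t, HasLaw (Z t) P μ) (hZind : iIndepFun Z μ)
    (I : Ω → Fin n) (hI : HasLaw I (uniformOn Set.univ) μ)
    (hMZ : IndepFun M (fun ω t => Z t ω) μ)
    (hMZI : IndepFun (fun ω => (M ω, fun t => Z t ω)) I μ) :
    ∫⁻ ω, risk P (amf η (M ω) (fun t => Z t ω) (I ω)) ∂μ =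
      (n : ℝ≥0∞)⁻¹ * ∫⁻ p, ∑ t ∈ Finset.range n, ∫⁻ z, risk P (amf η p z t)
        ∂(Measure.infinitePi fun _ : ℕ => P) ∂(mondrianMeasure d) := by
  have hZlaw : HasLaw (fun ω t => Z t ω) (Measure.infinitePi fun _ : ℕ => P) μ :=
    hZind.hasLaw_infinitePi hZ (aemeasurable_pi_lambda _ fun t => (hZ t).aemeasurable)
  have hMZlaw : HasLaw (fun ω => (M ω, fun t => Z t ω))
      ((mondrianMeasure d).prod (Measure.infinitePi fun _ : ℕ => P)) μ := by
    refine ⟨hM.aemeasurable.prodMk hZlaw.aemeasurable, ?_⟩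
    rw [(indepFun_iff_map_prod_eq_prod_map_map hM.aemeasurable hZlaw.aemeasurable).1 hMZ,
      hM.map_eq, hZlaw.map_eq]
  have : NeZero n := ⟨hn⟩
  have hlaw : HasLaw (fun ω => ((M ω, fun t => Z t ω), I ω))
      (((mondrianMeasure d).prod (Measure.infinitePi fun _ : ℕ => P)).prod
        (uniformOn (Set.univ : Set (Fin n)))) μ := by
    refine ⟨hMZlaw.aemeasurable.prodMk hI.aemeasurable, ?_⟩
    rw [(indepFun_iff_map_prod_eq_prod_map_map hMZlaw.aemeasurable hI.aemeasurable).1 hMZI,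
      hMZlaw.map_eq, hI.map_eq]
  have hmt : ∀ t : ℕ, Measurable fun q : TreePartition d × (ℕ → Cube d × ℝ) =>
      risk P (amf η q.1 q.2 t) := fun t => measurable_risk_amf hη P t
  have hm : Measurable fun q : (TreePartition d × (ℕ → Cube d × ℝ)) × Fin n =>
      risk P (amf η q.1.1 q.1.2 q.2) :=
    measurable_from_prod_countable_left fun t => hmt t
  have hunif : ∀ t : Fin n, uniformOn (Set.univ : Set (Fin n)) {t} = (n : ℝ≥0∞)⁻¹ := fun t => by
    rw [uniformOn_univ]
    simp
  rw [hlaw.lintegral_comp (f := fun q : (TreePartition d × (ℕ → Cube d × ℝ)) × Fin n =>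
    risk P (amf η q.1.1 q.1.2 q.2)) hm.aemeasurable, lintegral_prod _ hm.aemeasurable]
  simp only [lintegral_fintype, hunif]
  rw [lintegral_finsetSum _ fun (t : Fin n) _ => (hmt t).mul_const _,
    lintegral_finsetSum _ fun (t : ℕ) _ => (hmt t).lintegral_prod_right', Finset.mul_sum,
    ← Fin.sum_univ_eq_sum_range fun t => (n : ℝ≥0∞)⁻¹ * ∫⁻ p, ∫⁻ z, risk P (amf η p z t)
        ∂(Measure.infinitePi fun _ : ℕ => P) ∂(mondrianMeasure d)]
  refine Finset.sum_congr rfl fun t _ => ?_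
  rw [lintegral_mul_const _ (hmt t), lintegral_prod _ (hmt t).aemeasurable, mul_comm]

end Oracle

/-- Oracle inequality for the online-to-batch conversion of AMF. -/
theorem theorem1 {d : ℕ} [NeZero d] {B : ℝ} (hB : 0 < B)
    -- the law of the generic pair `(x, y)`, with `y ∈ [-B, B]`
    (P : Measure (Cube d × ℝ)) [IsProbabilityMeasure P]
    (hP : ∀ᵐ z ∂P, z.2 ∈ Set.Icc (-B) B)
    (n : ℕ) (hn : 2 ≤ n)
    -- the Mondrian partition, the i.i.d. samples and the uniformly random step
    {Ω : Type*} [MeasurableSpace Ω] (μ : Measure Ω) [IsProbabilityMeasure μ]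
    (M : Ω → TreePartition d) (hM : HasLaw M (mondrianMeasure d) μ)
    (Z : ℕ → Ω → Cube d × ℝ) (hZ : ∀ t, HasLaw (Z t) P μ) (hZind : iIndepFun Z μ)
    (I : Ω → Fin n) (hI : HasLaw I (uniformOn Set.univ) μ)
    (hMZ : IndepFun M (fun ω t => Z t ω) μ)
    (hMZI : IndepFun (fun ω => (M ω, fun t => Z t ω)) I μ)
    -- a random function that is constant on the cells of a time-pruned Mondrian partition
    (lam : ℝ) (hlam : 0 < lam)
    {Ω' : Type*} [MeasurableSpace Ω'] (ν : Measure Ω') [IsProbabilityMeasure ν]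
    (M' : Ω' → TreePartition d) (hM' : HasLaw M' (mondrianMeasure d) ν)
    (g : Ω' → Cube d → ℝ) (hg : Measurable (Function.uncurry g))
    (hgconst : ∀ᵐ ω' ∂ν, (M' ω').ConstOnCells lam (g ω')) :
    (∫⁻ ω, risk P (amf (1 / (8 * B ^ 2)) (M ω) (fun t => Z t ω) (I ω)) ∂μ) ≠ ∞ ∧
    (∫⁻ ω, risk P (amf (1 / (8 * B ^ 2)) (M ω) (fun t => Z t ω) (I ω)) ∂μ) ≤
      (∫⁻ ω', risk P (g ω') ∂ν) +
        ENNReal.ofReal (8 * B ^ 2 * (1 + lam) ^ d * (Real.log n / n)) := by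
  have hP' : ∀ᵐ z ∂P, |z.2| ≤ B := hP.mono fun z hz => abs_le.2 hz
  have hη : 0 ≤ 1 / (8 * B ^ 2) := by positivity
  have hn0 : (n : ℝ≥0∞) ≠ 0 := by simp; omega
  have hnt : (n : ℝ≥0∞) ≠ ∞ := ENNReal.natCast_ne_top n
  have hnR : (0 : ℝ) < n := by exact_mod_cast (by omega : 0 < n)
  have hlog : 0 ≤ Real.log n := Real.log_natCast_nonneg n
  rw [lintegral_risk_online_to_batch hη P (by omega) μ M hM Z hZ hZind I hI hMZ hMZI]
  set A : TreePartition d → ℝ≥0∞ := fun p => ∑ t ∈ Finset.range n,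
    ∫⁻ z, risk P (amf (1 / (8 * B ^ 2)) p z t) ∂(Measure.infinitePi fun _ : ℕ => P) with hA
  have hAm : Measurable A :=
    Finset.measurable_fun_sum _ fun t _ => (measurable_risk_amf hη P t).lintegral_prod_right'
  constructor
  · refine ENNReal.mul_ne_top (ENNReal.inv_ne_top.2 hn0) (ne_top_of_le_ne_top
      (b := ENNReal.ofReal ((4 * n - 3) * B ^ 2)) ENNReal.ofReal_ne_top ?_)
    exact (lintegral_mono fun p => sum_lintegral_risk_amf_le hη hB.le hP' (by omega)).trans (by simp)
  · set N : TreePartition d → ℝ≥0∞ := fun p =>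
      ∑' v : Node, {p : TreePartition d | p.IsLeafAt lam v}.indicator 1 p with hN
    have hNm : Measurable N :=
      Measurable.tsum fun v => measurable_one.indicator (measurableSet_isLeafAt lam v)
    have hfin : ∀ᵐ ω' ∂ν, {v | (M' ω').birth v ≤ lam}.Finite :=
      ae_of_ae_map hM'.aemeasurable (by rw [hM'.map_eq]; exact ae_finite_pruning lam)
    have hNM : AEMeasurable (fun ω' => ENNReal.ofReal (8 * B ^ 2 * Real.log n) * N (M' ω')) ν :=
      (hNm.comp_aemeasurable hM'.aemeasurable).const_mul _
    have hmain : ∫⁻ p, A p ∂(mondrianMeasure d) ≤ n * ∫⁻ ω', risk P (g ω') ∂ν +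
        ENNReal.ofReal (8 * B ^ 2 * Real.log n) * ENNReal.ofReal ((1 + lam) ^ d) := by
      -- The mean of `A` depends on the law of the partition only, so `M` may be replaced by `M'`,
      -- on whose pruned cells the comparison function is constant.
      calc ∫⁻ p, A p ∂(mondrianMeasure d) = ∫⁻ ω', A (M' ω') ∂ν :=
            (hM'.lintegral_comp hAm.aemeasurable).symm
        _ ≤ ∫⁻ ω', (n * risk P (g ω') + ENNReal.ofReal (8 * B ^ 2 * Real.log n) * N (M' ω')) ∂ν := by
            refine lintegral_mono_ae ?_
            filter_upwards [hgconst, hfin] with ω' h1 h2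
            exact sum_lintegral_risk_amf_le_of_finite hB hP' hlam.le h2 hg.of_uncurry_left h1 hn
        _ = n * ∫⁻ ω', risk P (g ω') ∂ν +
              ENNReal.ofReal (8 * B ^ 2 * Real.log n) * ∫⁻ p, N p ∂(mondrianMeasure d) := by
            rw [lintegral_add_right' _ hNM, lintegral_const_mul' _ _ hnt,
              lintegral_const_mul' _ _ ENNReal.ofReal_ne_top, hM'.lintegral_comp hNm.aemeasurable]
        _ ≤ _ := by
            gcongr
            exact lintegral_leaf_count_le hlam.le
    calc (n : ℝ≥0∞)⁻¹ * ∫⁻ p, A p ∂(mondrianMeasure d)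
        ≤ (n : ℝ≥0∞)⁻¹ * (n * ∫⁻ ω', risk P (g ω') ∂ν +
          ENNReal.ofReal (8 * B ^ 2 * Real.log n) * ENNReal.ofReal ((1 + lam) ^ d)) := by gcongr
      _ = _ := by
        rw [mul_add, ← mul_assoc, ENNReal.inv_mul_cancel hn0 hnt, one_mul,
          ← ENNReal.ofReal_mul (by positivity), ← ENNReal.ofReal_natCast,
          ← ENNReal.ofReal_inv_of_pos hnR, ← ENNReal.ofReal_mul (by positivity)]
        congr 2
        ring
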